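/- Let $k$ be an algebraically closed field of characteristic zero and let $s \ge 3$. Let $L_1,\dots,L_s$ be pairwise disjoint lines in $\mathbb{P}^3 = \mathbb{P}^3_k$, let $\mathbb{X} = L_1+\cdots+L_s$ be their (reduced) union, and let $H \subset \mathbb{P}^3$ be a plane containing $L_1$ (for example a generic one). Then there exist a point $P$, lines $L_2',\dots,L_s'$, and a flat family of closed subschemes $\mathbb{X}_\lambda \subset \mathbb{P}^3$, $\lambda \in k$, i.e. a closed subscheme of $\mathbb{P}^3 \times \mathbb{A}^1$ that is flat over $\mathbb{A}^1 = \operatorname{Spec} k[\lambda]$ and has fiber $\mathbb{X}_\lambda$ over $\lambda$, such that: 1. $L_1, L_2', \dots, L_s'$ are $s$ distinct lines in $H$ with $L_1 \cap L_2' \cap \cdots \cap L_s' = P$; 2. the special fiber $\mathbb{X}_0$ is the $(2,s)$-cone configuration $$\mathbb{X}_0 = L_1 + L_2' + \cdots + L_s' + D_{H,s}(P), \qquad D_{H,s}(P) = sP \cap 2H,$$ where $+$ is the schematic union (intersection of ideal sheaves) and $D_{H,s}(P)$ is the closed subscheme of $\mathbb{P}^3$ with ideal sheaf $\mathcal{I}_P^{\,s}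 + \mathcal{I}_H^{\,2}$; 3. the general fiber is a union of $s$ disjoint lines: for all but finitely many $\lambda \in k$, the scheme $\mathbb{X}_\lambda$ is the (reduced) union of $s$ pairwise disjoint lines; 4. the given scheme $\mathbb{X}$ is one of the fibers $\mathbb{X}_\lambda$. -/

import Mathlib

open AlgebraicGeometry CategoryTheory TopologicalSpace

universe u

noncomputable section

namespace LineDegeneration

/-- The standard grading by degree of the homogeneous coordinate ring `A[T₀, T₁, T₂, T₃]`. -/
abbrev grading (A : Type u) [CommRing A] : ℕ → Submodule A (MvPolynomial (Fin 4) A) :=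
  MvPolynomial.homogeneousSubmodule (Fin 4) A

instance (A : Type u) [CommRing A] : GradedAlgebra (grading A) :=
  MvPolynomial.gradedAlgebra

/-- Projective 3-space over (the spectrum of) a commutative ring `A`, as a scheme:
`ℙ³_A = Proj A[T₀, T₁, T₂, T₃]`. -/
abbrev P3 (A : Type u) [CommRing A] : Scheme.{u} := Proj (grading A)

/-- The structure morphism `ℙ³_A ⟶ Spec A`. -/
def P3.toSpec (A : Type u) [CommRing A] : P3 A ⟶ Spec (.of A) :=
  Proj.toSpecZero (grading A) ≫
    Spec.map (CommRingCat.ofHom (algebraMap A (grading A 0)))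

/-- The graded ring homomorphism `A[T₀, T₁, T₂, T₃] → B[T₀, T₁, T₂, T₃]` that applies `φ : A → B`
to the coefficients. -/
def coeffMap {A B : Type u} [CommRing A] [CommRing B] (φ : A →+* B) :
    GradedRingHom (grading A) (grading B) where
  __ := MvPolynomial.map φ
  map_mem := fun {_ x} hx =>
    (MvPolynomial.mem_homogeneousSubmodule _ _).2
      (((MvPolynomial.mem_homogeneousSubmodule _ x).1 hx).map φ)

/-- The irrelevant ideal of `B[T₀, T₁, T₂, T₃]` is generated by the image of the irrelevant ideal
of `A[T₀, T₁, T₂, T₃]`. -/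
theorem irrelevant_le_map_coeffMap {A B : Type u} [CommRing A] [CommRing B] (φ : A →+* B) :
    HomogeneousIdeal.irrelevant (grading B) ≤
      (HomogeneousIdeal.irrelevant (grading A)).map (coeffMap φ) := by
  rw [HomogeneousIdeal.irrelevant_le]
  intro i hi x hx
  have hx' : x.IsHomogeneous i := (MvPolynomial.mem_homogeneousSubmodule _ _).1 hx
  have h1 : x ∈ Ideal.span (MvPolynomial.X '' (Set.univ : Set (Fin 4)) :
      Set (MvPolynomial (Fin 4) B)) := by
    rw [MvPolynomial.mem_ideal_span_X_image]
    intro m hm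
    by_contra! hcon
    have hm0 : m = 0 := Finsupp.ext fun j => hcon j (Set.mem_univ j)
    have := hx' (MvPolynomial.mem_support_iff.1 hm)
    simp [hm0] at this
    omega
  have h2 : Ideal.span (MvPolynomial.X '' (Set.univ : Set (Fin 4)) :
      Set (MvPolynomial (Fin 4) B)) ≤
      Ideal.map (coeffMap φ) (HomogeneousIdeal.irrelevant (grading A)).toIdeal := by
    rw [Ideal.span_le]
    rintro _ ⟨j, -, rfl⟩
    have hX : coeffMap φ (MvPolynomial.X j) = MvPolynomial.X j := MvPolynomial.map_X φ j
    rw [SetLike.mem_coe, ← hX]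
    exact Ideal.mem_map_of_mem _ (HomogeneousIdeal.mem_irrelevant_of_mem _ Nat.one_pos
      ((MvPolynomial.mem_homogeneousSubmodule _ _).2 (MvPolynomial.isHomogeneous_X A j)))
  exact h2 h1

/-- The morphism `ℙ³_B ⟶ ℙ³_A` induced by `φ : A → B`, i.e. the base change of
`Spec B ⟶ Spec A`. -/
def P3.map {A B : Type u} [CommRing A] [CommRing B] (φ : A →+* B) : P3 B ⟶ P3 A :=
  Proj.map (coeffMap φ) (irrelevant_le_map_coeffMap φ)

variable {k : Type u} [Field k]

/-- `Z` is a linear subspace of `ℙ³` of codimension `c`: the common zero locus of `c` linearly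
independent linear forms (a plane for `c = 1`, a line for `c = 2`, a point for `c = 3`). The
points `x` of the scheme `Proj` are the relevant homogeneous prime ideals. -/
def IsLinearSubspace (c : ℕ) (Z : Closeds (P3 k)) : Prop :=
  ∃ f : Fin c → MvPolynomial (Fin 4) k,
    (∀ i, (f i).IsHomogeneous 1) ∧ LinearIndependent k f ∧
      ∀ x : P3 k, x ∈ Z ↔ ∀ i, f i ∈ x.asHomogeneousIdeal

abbrev IsPlane (Z : Closeds (P3 k)) : Prop := IsLinearSubspace 1 Z

abbrev IsLine (Z : Closeds (P3 k)) : Prop := IsLinearSubspace 2 Z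

abbrev IsPoint (Z : Closeds (P3 k)) : Prop := IsLinearSubspace 3 Z

/-! Closed subschemes are given by their ideal sheaves. A linear subspace carries its reduced
structure; the schematic union of subschemes is given by the intersection of the ideal sheaves,
and the schematic intersection by their sum. -/

/-- The ideal sheaf of a closed subset with its reduced structure. -/
abbrev idealSheaf (Z : Closeds (P3 k)) : (P3 k).IdealSheafData :=
  Scheme.IdealSheafData.vanishingIdeal Z

/-- The ideal sheaf of the schematic union `Z₁ + ⋯ + Zₛ`. -/
def unionSheaf {s : ℕ} (Z : Fin s → Closeds (P3 k)) : (P3 k).IdealSheafData :=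
  ⨅ i, idealSheaf (Z i)

/-- The ideal sheaf `𝓘_P ^ m + 𝓘_H ^ 2` of `D_{H,m}(P) = mP ∩ 2H`. -/
def fatPointSheaf (H P : Closeds (P3 k)) (m : ℕ) : (P3 k).IdealSheafData :=
  idealSheaf P ^ m ⊔ idealSheaf H ^ 2

/-- `L₁, …, Lₛ` are `s` (distinct) lines in the plane `H` that meet in the single point `P`. -/
structure IsPlaneCone {s : ℕ} (H P : Closeds (P3 k)) (L : Fin s → Closeds (P3 k)) : Prop where
  isPlane : IsPlane H
  isPoint : IsPoint P
  isLine : ∀ i, IsLine (L i)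
  injective : Function.Injective L
  le_plane : ∀ i, L i ≤ H
  iInf_eq : ⨅ i, L i = P

/-- The ideal sheaf of `L₁ + ⋯ + Lₛ + D_{H,s}(P)`, which is the `(2,s)`-cone configuration when
`IsPlaneCone H P L` holds. -/
def coneSheaf {s : ℕ} (H P : Closeds (P3 k)) (L : Fin s → Closeds (P3 k)) :
    (P3 k).IdealSheafData :=
  unionSheaf L ⊓ fatPointSheaf H P s

/-- `Z₁, …, Zₛ` are pairwise disjoint lines. -/
def AreDisjointLines {s : ℕ} (Z : Fin s → Closeds (P3 k)) : Prop :=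
  (∀ i, IsLine (Z i)) ∧ Pairwise fun i j => Disjoint (Z i) (Z j)

/-- A flat family of closed subschemes of `ℙ³_k` over the affine line `𝔸¹ = Spec k[λ]`: a closed
subscheme of `ℙ³ × 𝔸¹ = ℙ³_{k[λ]}` (given by its ideal sheaf) that is flat over `𝔸¹`. -/
structure FlatFamily (k : Type u) [Field k] where
  sheaf : (P3 (Polynomial k)).IdealSheafData
  flat : Flat (sheaf.subschemeι ≫ P3.toSpec (Polynomial k))

/-- The ideal sheaf of the fiber over `λ = a` of a family, a closed subscheme of `ℙ³_k`: the
pullback of the family along the inclusion `ℙ³_k ⟶ ℙ³_{k[λ]}` of the fiber of `ℙ³ × 𝔸¹` over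
`a`. -/
def FlatFamily.fiber (X : FlatFamily k) (a : k) : (P3 k).IdealSheafData :=
  X.sheaf.comap (P3.map (Polynomial.evalRingHom a))

end LineDegeneration

end

/-!
Finitely many pairwise disjoint lines admit a common skew line, and in coordinates `X₀, …, X₃` with
the skew line `X₁ = X₂ = 0`, the plane `X₃ = 0` and the first line `X₀ = X₃ = 0`, the `i`-th line is
a graph `X₀ = uᵢ X₁ + vᵢ X₂`, `X₃ = aᵢ X₁ + bᵢ X₂` (`exists_basis_lineParam`). With distinct scalars
`mᵢ`, the first of them zero, and a large `N`, the `i`-th line moves with the parameter `λ` as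
`X₀ = (mᵢ + λ (uᵢ - mᵢ)) X₁ + λ (mᵢ² + λ (vᵢ - mᵢ²)) X₂`, `X₃ = λ ^ N (aᵢ X₁ + bᵢ X₂)`,
so that it is the given line for `λ = 1` and the line `X₀ = mᵢ X₁`, `X₃ = 0` for `λ = 0`
(`movingLine`). The union of the moving lines is the family: its ideal, an intersection of primes
which meet `k[λ]` in zero, has a torsion-free quotient, hence it is flat (`flat_of_torsionFree`).

On the affine charts of `ℙ³`, the ideal of the fiber over `λ = c` is the extension of the image
`fiberIdeal` of the total ideal under `λ ↦ c` (`comap_ideal`). It lies between the product and the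
intersection of the ideals of the lines at `c`, and these agree where the lines are disjoint
(`lineFamily_fiber_eq_unionSheaf`). The lines are disjoint unless one of finitely many nonzero
polynomials in `λ` vanishes at `c`. It remains to identify the fiber at `0`.

The special fiber is contained in the cone (`exists_X_pow_mul_mem_fiberIdeal`): modulo `λ ^ N` all
the moving lines lie in the plane `X₃ = 0`, so the product of the equations in `X₀, X₁, X₂` of all
but `r` of the lines, times `X₃ ^ r`, is at `λ = 0` an equation of the special fiber. This remains
true after division of linear combinations of such products by a power of `λ` less than `N`. For
`r = 1` this gives `X₃` times the forms of degree `s - 1` in `X₀, X₁`. For `r = 2` it gives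
`X₂ ^ (s - 2) X₃²`, because no three of the plane lines are concurrent for general `λ`: to first
order in `λ` the condition is the nonvanishing of a Vandermonde determinant in the `mᵢ`. That is why
the movement starts in the direction `mᵢ²`.

The special fiber contains the cone (`fiberIdeal_zero_le_coneIdeal`): the projections to the plane
of two of the moving lines meet in a point close to `X₀ = X₁ = 0`, and the two points of the lines
above it differ and have a coordinate `X₃` divisible by `λ ^ N`. Hence the coefficient of `X₃` in an
equation of the family is divisible by `λ ^ N` at that point (`X_pow_dvd_eval₂_rescale`). After
rescaling `X₀, X₁` by `λ`, its coefficients of order at most `s - 2` in `λ` define plane curves of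
degree at most `s - 2` in `X₀, X₁` through the intersection points of the lines
`X₀ = mᵢ X₁ + mᵢ² X₂` (`rescaledCoeff_eq_zero`), and these are zero (`eq_zero_of_eval_eq_zero`).
-/

namespace LineDegeneration

open MvPolynomial HomogeneousLocalization

/-! ### Dehomogenization -/

section Chart

variable {A : Type u} [CommRing A]

theorem mem_grading {n : MvPolynomial (Fin 4) A} {d : ℕ} :
    n ∈ grading A d ↔ n.IsHomogeneous d :=
  MvPolynomial.mem_homogeneousSubmodule _ _

theorem decompose_apply_grading (i : MvPolynomial (Fin 4) A) (e : ℕ) :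
    (DirectSum.decompose (grading A) i e : MvPolynomial (Fin 4) A) = homogeneousComponent e i :=
  MvPolynomial.decomposition.decompose'_apply i e

/-- Dehomogenization with respect to a linear form `f`: the ring homomorphism from the homogeneous
coordinate ring to the coordinate ring of `D₊(f)` that sends `Tⱼ` to `Tⱼ / f`. -/
noncomputable def dehom (f : MvPolynomial (Fin 4) A) (hf : f ∈ grading A 1) :
    MvPolynomial (Fin 4) A →+* Away (grading A) f :=
  eval₂Hom ((fromZeroRingHom (grading A) (Submonoid.powers f)).comp (algebraMap A (grading A 0)))
    fun j => Away.mk (grading A) hf 1 (X j)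
      (by rw [smul_eq_mul, one_mul]; exact mem_grading.2 (isHomogeneous_X A j))

variable {f : MvPolynomial (Fin 4) A} (hf : f ∈ grading A 1)

theorem val_dehom_mul_pow {n : MvPolynomial (Fin 4) A} {d : ℕ} (hn : n.IsHomogeneous d) :
    (dehom f hf n).val * (algebraMap (MvPolynomial (Fin 4) A) (Localization.Away f) f) ^ d =
      algebraMap (MvPolynomial (Fin 4) A) (Localization.Away f) n := by
  have hX (j : Fin 4) : (dehom f hf (X j)).val *
      algebraMap (MvPolynomial (Fin 4) A) (Localization.Away f) f =
      algebraMap (MvPolynomial (Fin 4) A) (Localization.Away f) (X j) := by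
    simp only [dehom, coe_eval₂Hom, eval₂_X, Away.val_mk]
    rw [Localization.mk_eq_mk', ← IsLocalization.mk'_one (M := Submonoid.powers f),
      ← IsLocalization.mk'_mul, IsLocalization.mk'_eq_iff_eq_mul]
    simp [mul_comm]
  have hC (a : A) : (dehom f hf (C a)).val =
      algebraMap (MvPolynomial (Fin 4) A) (Localization.Away f) (C a) := by
    simp only [dehom, coe_eval₂Hom, eval₂_C, RingHom.comp_apply, fromZeroRingHom]
    change Localization.mk _ _ = _
    rw [Localization.mk_eq_mk']
    exact IsLocalization.mk'_one _ _
  let ψ : MvPolynomial (Fin 4) A →+* Localization.Away f :=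
    (algebraMap (Away (grading A) f) (Localization.Away f)).comp (dehom f hf)
  have hψ (n) : (dehom f hf n).val = ψ n := rfl
  rw [hψ]
  conv_lhs => rw [n.as_sum]
  conv_rhs => rw [n.as_sum]
  rw [map_sum, map_sum, Finset.sum_mul]
  refine Finset.sum_congr rfl fun m hm => ?_
  have hd : ∑ j ∈ m.support, m j = d := by
    rw [← Finsupp.degree_apply, Finsupp.degree_eq_weight_one]
    exact hn (mem_support_iff.1 hm)
  rw [monomial_eq, map_mul, map_mul, ← hψ, hC, mul_assoc, Finsupp.prod, map_prod, map_prod, ← hd,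
    ← Finset.prod_pow_eq_pow_sum, ← Finset.prod_mul_distrib]
  congr 1
  refine Finset.prod_congr rfl fun j _ => ?_
  rw [map_pow, map_pow, ← hψ, ← mul_pow, hX]

/-- The dehomogenization of a form `n` of degree `d` is the fraction `n / f ^ d`. -/
theorem dehom_eq_mk {n : MvPolynomial (Fin 4) A} {d : ℕ} (hn : n ∈ grading A (d • 1)) :
    dehom f hf n = Away.mk (grading A) hf d n hn := by
  apply val_injective
  have hn' : n.IsHomogeneous d := by simpa using mem_grading.1 hn
  have hu : IsUnit ((algebraMap (MvPolynomial (Fin 4) A) (Localization.Away f) f) ^ d) :=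
    (IsLocalization.Away.algebraMap_isUnit f).pow d
  rw [← hu.mul_left_inj, val_dehom_mul_pow hf hn', Away.val_mk, Localization.mk_eq_mk',
    ← map_pow]
  exact (IsLocalization.mk'_spec' (M := Submonoid.powers f) _ n ⟨f ^ d, d, rfl⟩).symm.trans
    (mul_comm _ _)

theorem exists_dehom_eq (z : Away (grading A) f) :
    ∃ (d : ℕ) (n : MvPolynomial (Fin 4) A), n.IsHomogeneous d ∧ dehom f hf n = z := by
  obtain ⟨d, n, hn, rfl⟩ := Away.mk_surjective (grading A) hf z
  exact ⟨d, n, by simpa using mem_grading.1 hn, dehom_eq_mk hf hn⟩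

theorem dehom_self : dehom f hf f = 1 := by
  apply val_injective
  have hu : IsUnit ((algebraMap (MvPolynomial (Fin 4) A) (Localization.Away f) f) ^ 1) :=
    (IsLocalization.Away.algebraMap_isUnit f).pow 1
  rw [← hu.mul_left_inj, val_dehom_mul_pow hf (mem_grading.1 hf)]
  simp

/-- Two forms of the same degree with the same dehomogenization agree up to a power of `f`. -/
theorem exists_pow_mul_eq {n m : MvPolynomial (Fin 4) A} {d : ℕ} (hn : n.IsHomogeneous d)
    (hm : m.IsHomogeneous d) (h : dehom f hf n = dehom f hf m) :
    ∃ e, f ^ e * n = f ^ e * m := by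
  have h1 : algebraMap (MvPolynomial (Fin 4) A) (Localization.Away f) n =
      algebraMap (MvPolynomial (Fin 4) A) (Localization.Away f) m := by
    rw [← val_dehom_mul_pow hf hn, ← val_dehom_mul_pow hf hm, h]
  obtain ⟨⟨_, e, rfl⟩, he⟩ := (IsLocalization.eq_iff_exists (Submonoid.powers f) _).1 h1
  exact ⟨e, he⟩

/-- A form lies in the extension of a homogeneous ideal `I` to `D₊(f)` if and only if a power of
`f` multiplies it into `I`. -/
theorem dehom_mem_map_iff {I : Ideal (MvPolynomial (Fin 4) A)} (hI : I.IsHomogeneous (grading A))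
    {n : MvPolynomial (Fin 4) A} {d : ℕ} (hn : n.IsHomogeneous d) :
    dehom f hf n ∈ I.map (dehom f hf) ↔ ∃ e, f ^ e * n ∈ I := by
  have hsurj : Function.Surjective (dehom f hf) := fun z =>
    let ⟨_, n, _, h⟩ := exists_dehom_eq hf z; ⟨n, h⟩
  have hf1 : f.IsHomogeneous 1 := mem_grading.1 hf
  constructor
  · intro h
    obtain ⟨i, hi, hin⟩ := (Ideal.mem_map_iff_of_surjective _ hsurj).1 h
    let D := d + i.totalDegree
    let i' := ∑ e ∈ Finset.range (i.totalDegree + 1), f ^ (D - e) * homogeneousComponent e i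
    have hi' : i' ∈ I := Ideal.sum_mem _ fun e _ => I.mul_mem_left _ (by
      have := hI e hi
      rwa [decompose_apply_grading] at this)
    have hi'D : i'.IsHomogeneous D := by
      refine IsHomogeneous.sum _ _ _ fun e he => ?_
      have := (hf1.pow (D - e)).mul (homogeneousComponent_isHomogeneous e i)
      rwa [show 1 * (D - e) + e = D by have := Finset.mem_range.1 he; omega] at this
    have hn' : (f ^ (D - d) * n).IsHomogeneous D := by
      have := (hf1.pow (D - d)).mul hn
      rwa [show 1 * (D - d) + d = D by omega] at this
    have heq : dehom f hf (f ^ (D - d) * n) = dehom f hf i' := by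
      rw [map_mul, map_pow, dehom_self, one_pow, one_mul, ← hin]
      conv_lhs => rw [← sum_homogeneousComponent i]
      simp only [i', map_sum, map_mul, map_pow, dehom_self, one_pow, one_mul]
    obtain ⟨e, he⟩ := exists_pow_mul_eq hf hn' hi'D heq
    refine ⟨e + (D - d), ?_⟩
    rw [pow_add, mul_assoc, he]
    exact I.mul_mem_left _ hi'
  · rintro ⟨e, he⟩
    have := Ideal.mem_map_of_mem (dehom f hf) he
    rwa [map_mul, map_pow, dehom_self, one_pow, one_mul] at this

end Chart

/-! ### Affine charts of projective space -/

section Chart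

variable {A : Type u} [CommRing A] {f : MvPolynomial (Fin 4) A} (hf : f ∈ grading A 1)

/-- The affine chart `D₊(f)` of `ℙ³` defined by a linear form `f`. -/
noncomputable def chart (f : MvPolynomial (Fin 4) A) (hf : f ∈ grading A 1) : (P3 A).affineOpens :=
  ⟨Proj.basicOpen (grading A) f, Proj.isAffineOpen_basicOpen (grading A) f hf one_pos⟩

/-- The isomorphism from the degree-zero localization at `f` to the sections over `D₊(f)`, as a
ring homomorphism. -/
noncomputable def awaySection (f : MvPolynomial (Fin 4) A) (hf : f ∈ grading A 1) :
    Away (grading A) f →+* Γ(P3 A, (chart f hf).1) :=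
  (Proj.awayToSection (grading A) f).hom

/-- Dehomogenization as a ring homomorphism to the sections over the chart `D₊(f)`. -/
noncomputable def chartHom (f : MvPolynomial (Fin 4) A) (hf : f ∈ grading A 1) :
    MvPolynomial (Fin 4) A →+* Γ(P3 A, (chart f hf).1) :=
  (awaySection f hf).comp (dehom f hf)

theorem awaySection_bijective : Function.Bijective (awaySection f hf) := by
  have : IsIso (Proj.awayToSection (grading A) f) := by
    rw [← Proj.basicOpenIsoAway_hom (grading A) f hf one_pos]
    infer_instance
  exact ConcreteCategory.bijective_of_isIso (Proj.awayToSection (grading A) f)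

theorem chartHom_self : chartHom f hf f = 1 := by
  rw [chartHom, RingHom.comp_apply, dehom_self, map_one]

theorem exists_chartHom_eq (z : Γ(P3 A, (chart f hf).1)) :
    ∃ (d : ℕ) (n : MvPolynomial (Fin 4) A), n.IsHomogeneous d ∧ chartHom f hf n = z := by
  obtain ⟨z, rfl⟩ := (awaySection_bijective hf).2 z
  obtain ⟨d, n, hn, rfl⟩ := exists_dehom_eq hf z
  exact ⟨d, n, hn, rfl⟩

theorem chartHom_mem_map_iff {I : Ideal (MvPolynomial (Fin 4) A)}
    (hI : I.IsHomogeneous (grading A)) {n : MvPolynomial (Fin 4) A} {d : ℕ}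
    (hn : n.IsHomogeneous d) :
    chartHom f hf n ∈ I.map (chartHom f hf) ↔ ∃ e, f ^ e * n ∈ I := by
  rw [← dehom_mem_map_iff hf hI hn, chartHom, ← Ideal.map_map, RingHom.comp_apply]
  refine ⟨fun h => ?_, fun h => Ideal.mem_map_of_mem _ h⟩
  obtain ⟨x, hx, hxn⟩ :=
    (Ideal.mem_map_iff_of_surjective _ (awaySection_bijective hf).2).1 h
  rwa [← (awaySection_bijective hf).1 hxn]

/-- Extension to a chart commutes with finite intersections of homogeneous ideals. -/
theorem map_chartHom_inf {I J : Ideal (MvPolynomial (Fin 4) A)}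
    (hI : I.IsHomogeneous (grading A)) (hJ : J.IsHomogeneous (grading A)) :
    (I ⊓ J).map (chartHom f hf) = I.map (chartHom f hf) ⊓ J.map (chartHom f hf) := by
  refine le_antisymm (Ideal.map_inf_le _) fun z hz => ?_
  obtain ⟨d, n, hn, rfl⟩ := exists_chartHom_eq hf z
  obtain ⟨e₁, h₁⟩ := (chartHom_mem_map_iff hf hI hn).1 hz.1
  obtain ⟨e₂, h₂⟩ := (chartHom_mem_map_iff hf hJ hn).1 hz.2
  refine (chartHom_mem_map_iff hf (hI.inf hJ) hn).2 ⟨e₁ + e₂, ?_, ?_⟩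
  · rw [add_comm, pow_add, mul_assoc]
    exact I.mul_mem_left _ h₁
  · rw [pow_add, mul_assoc]
    exact J.mul_mem_left _ h₂

theorem map_chartHom_iInf {ι : Type*} [Finite ι] {I : ι → Ideal (MvPolynomial (Fin 4) A)}
    (hI : ∀ i, (I i).IsHomogeneous (grading A)) :
    (⨅ i, I i).map (chartHom f hf) = ⨅ i, (I i).map (chartHom f hf) := by
  refine le_antisymm (le_iInf fun i => Ideal.map_mono (iInf_le _ i)) fun z hz => ?_
  obtain ⟨d, n, hn, rfl⟩ := exists_chartHom_eq hf z
  choose e he using fun i => (chartHom_mem_map_iff hf (hI i) hn).1 ((Ideal.mem_iInf.1 hz) i)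
  cases nonempty_fintype ι
  refine (chartHom_mem_map_iff hf (Ideal.IsHomogeneous.iInf hI) hn).2
    ⟨∑ i, e i, Ideal.mem_iInf.2 fun i => ?_⟩
  rw [← Nat.sub_add_cancel (Finset.single_le_sum (f := e) (fun _ _ => Nat.zero_le _)
    (Finset.mem_univ i)), pow_add, mul_assoc]
  exact (I i).mul_mem_left _ (he i)

/-- A dehomogenized form is invertible at a point of the chart if and only if the form is not in
the homogeneous prime ideal of the point. -/
theorem mem_basicOpen_chartHom {n : MvPolynomial (Fin 4) A} {d : ℕ} (hn : n.IsHomogeneous d)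
    {x : P3 A} (hx : f ∉ x.asHomogeneousIdeal) :
    x ∈ (P3 A).basicOpen (chartHom f hf n) ↔ n ∉ x.asHomogeneousIdeal := by
  have hx' : x ∈ (chart f hf).1 := hx
  have : x.asHomogeneousIdeal.toIdeal.IsPrime := x.isPrime
  rw [Scheme.mem_basicOpen _ _ _ hx', chartHom, RingHom.comp_apply]
  have hgerm : (P3 A).presheaf.germ (chart f hf).1 x hx' (awaySection f hf (dehom f hf n)) =
      (Proj.stalkIso' (grading A) x).symm
        (HomogeneousLocalization.mapId (grading A) (Submonoid.powers_le.mpr hx)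
          (dehom f hf n)) :=
    ConcreteCategory.congr_hom (ProjectiveSpectrum.Proj.awayToSection_germ (grading A) f x hx)
      (dehom f hf n)
  have hn' : n ∈ grading A (d • 1) := by simpa using mem_grading.2 hn
  rw [hgerm, dehom_eq_mk hf hn']
  refine (MulEquiv.isUnit_map (Proj.stalkIso' (grading A) x).symm).trans ?_
  rw [← isUnit_iff_isUnit_val]
  have hval : (HomogeneousLocalization.mapId (grading A)
      (Submonoid.powers_le.mpr hx : _ ≤ x.asHomogeneousIdeal.toIdeal.primeCompl)
      (Away.mk (grading A) hf d n hn')).val =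
      IsLocalization.mk' (Localization.AtPrime x.asHomogeneousIdeal.toIdeal) n
        (⟨f ^ d, fun h => hx (x.isPrime.mem_of_pow_mem _ h)⟩ :
          x.asHomogeneousIdeal.toIdeal.primeCompl) := by
    rw [← Localization.mk_eq_mk']
    rfl
  rw [hval, IsLocalization.AtPrime.isUnit_mk'_iff]
  rfl

/-- Over affine opens, the reduced ideal sheaf consists of the functions without invertible value at
the points of the closed subset. -/
theorem mem_vanishingIdeal_ideal_iff {X : Scheme.{u}} (Z : Closeds X) (U : X.affineOpens)
    (z : Γ(X, U.1)) :
    z ∈ (Scheme.IdealSheafData.vanishingIdeal Z).ideal U ↔ ∀ x ∈ Z, x ∉ X.basicOpen z := by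
  rw [Scheme.IdealSheafData.vanishingIdeal_ideal, PrimeSpectrum.mem_vanishingIdeal]
  constructor
  · intro h x hx hxz
    have hxU : x ∈ U.1 := X.basicOpen_le z hxz
    rw [← SetLike.mem_coe, ← U.2.range_fromSpec] at hxU
    obtain ⟨p, rfl⟩ := hxU
    have hp : p ∈ U.2.fromSpec ⁻¹ᵁ X.basicOpen z := hxz
    rw [U.2.fromSpec_preimage_basicOpen] at hp
    exact hp (h p hx)
  · intro h p hp
    by_contra hzp
    have : p ∈ U.2.fromSpec ⁻¹ᵁ X.basicOpen z := by
      rw [U.2.fromSpec_preimage_basicOpen]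
      exact hzp
    exact h _ hp this

/-- The reduced ideal sheaf of the zero locus of a homogeneous prime ideal `I` is the one
associated with `I`. -/
theorem vanishingIdeal_ideal_chart {I : Ideal (MvPolynomial (Fin 4) A)}
    (hI : I.IsHomogeneous (grading A)) (hIp : I.IsPrime) {Z : Closeds (P3 A)}
    (hZ : ∀ x : P3 A, x ∈ Z ↔ I ≤ x.asHomogeneousIdeal.toIdeal) :
    (Scheme.IdealSheafData.vanishingIdeal Z).ideal (chart f hf) = I.map (chartHom f hf) := by
  ext z
  obtain ⟨d, n, hn, rfl⟩ := exists_chartHom_eq hf z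
  rw [mem_vanishingIdeal_ideal_iff]
  constructor
  · intro h
    by_cases hfI : f ∈ I
    · have := Ideal.mem_map_of_mem (chartHom f hf) hfI
      rw [chartHom_self, ← Ideal.eq_top_iff_one] at this
      rw [this]
      trivial
    · let x : P3 A := ⟨⟨I, hI⟩, hIp, fun hle => hfI
        (hle (HomogeneousIdeal.mem_irrelevant_of_mem _ one_pos hf))⟩
      have := h x ((hZ x).2 le_rfl)
      rw [mem_basicOpen_chartHom hf hn hfI, not_not] at this
      exact Ideal.mem_map_of_mem _ this
  · intro h x hx hxn
    have hxf : f ∉ x.asHomogeneousIdeal := (P3 A).basicOpen_le _ hxn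
    obtain ⟨e, he⟩ := (chartHom_mem_map_iff hf hI hn).1 h
    have := (hZ x).1 hx he
    rcases x.isPrime.mem_or_mem this with h1 | h1
    · exact hxf (x.isPrime.mem_of_pow_mem _ h1)
    · exact (mem_basicOpen_chartHom hf hn hxf).1 hxn h1

end Chart

/-! ### Pullback of ideal sheaves over affine opens -/

open Scheme IdealSheafData in
theorem comap_ideal_le {X Y : Scheme.{u}} (I : Y.IdealSheafData) (f : X ⟶ Y) (U : Y.affineOpens)
    (V : X.affineOpens) (e : V.1 ≤ f ⁻¹ᵁ U.1) :
    (I.comap f).ideal V ≤ (I.ideal U).map (f.appLE U V e).hom := by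
  -- The closed subscheme of `V` cut out by the right-hand side maps into the one defined by `I`.
  have hU : IsAffineOpen U.1 := U.2
  have hV : IsAffineOpen V.1 := V.2
  let K := (I.ideal U).map (f.appLE U V e).hom
  let q : Γ(X, V.1) ⟶ CommRingCat.of (Γ(X, V.1) ⧸ K) := CommRingCat.ofHom (Ideal.Quotient.mk K)
  let h : Spec (.of (Γ(X, V.1) ⧸ K)) ⟶ X := Spec.map q ≫ hV.fromSpec
  let q' : CommRingCat.of (Γ(Y, U.1) ⧸ I.ideal U) ⟶ CommRingCat.of (Γ(X, V.1) ⧸ K) :=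
    CommRingCat.ofHom (Ideal.quotientMap K (f.appLE U V e).hom Ideal.le_comap_map)
  let mkU : Γ(Y, U.1) ⟶ CommRingCat.of (Γ(Y, U.1) ⧸ I.ideal U) :=
    CommRingCat.ofHom (Ideal.Quotient.mk (I.ideal U))
  have hq : f.appLE U V e ≫ q = mkU ≫ q' := by
    ext x
    simp [q, q', mkU]
  have hfac : Spec.map mkU ≫ hU.fromSpec = I.subschemeCover.f U ≫ I.subschemeι :=
    ((I.subschemeCover_map_subschemeι U).trans (I.glueDataObjι_ι U)).symm
  have hf : h ≫ f = (Spec.map q' ≫ I.subschemeCover.f U) ≫ I.subschemeι := by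
    calc h ≫ f = Spec.map q ≫ hV.fromSpec ≫ f := Category.assoc _ _ _
      _ = Spec.map q ≫ Spec.map (f.appLE U V e) ≫ hU.fromSpec := by
        rw [IsAffineOpen.SpecMap_appLE_fromSpec]
      _ = Spec.map (f.appLE U V e ≫ q) ≫ hU.fromSpec := by
        rw [Spec.map_comp, Category.assoc]
      _ = Spec.map q' ≫ Spec.map mkU ≫ hU.fromSpec := by
        rw [hq, Spec.map_comp, Category.assoc]
      _ = Spec.map q' ≫ I.subschemeCover.f U ≫ I.subschemeι := congrArg _ hfac
      _ = _ := (Category.assoc _ _ _).symm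
  have h1 : I.comap f ≤ h.ker := by
    rw [← le_map_iff_comap_le, map_ker, hf]
    conv_lhs => rw [← I.ker_subschemeι]
    exact Hom.le_ker_comp _ _
  intro s hs
  have h2 : h.app V.1 s = 0 := h.ideal_ker_le V (h1 V hs)
  have e1 : ⊤ ≤ hV.fromSpec ⁻¹ᵁ V.1 := hV.fromSpec_preimage_self.ge
  have h3 : h.appLE V.1 ⊤ (by exact fun x _ => e1 trivial) s = 0 := by
    simp only [Scheme.Hom.appLE, CommRingCat.comp_apply, h2, map_zero]
  have h4 : hV.fromSpec.appLE V.1 ⊤ e1 = (ΓSpecIso Γ(X, V.1)).inv := by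
    rw [Scheme.Hom.appLE, IsAffineOpen.fromSpec_app_self, Category.assoc, ← Functor.map_comp]
    exact (congrArg _ ((Spec Γ(X, V.1)).presheaf.map_id _)).trans (Category.comp_id _)
  have h5 : h.appLE V.1 ⊤ (by exact fun x _ => e1 trivial) =
      q ≫ (ΓSpecIso (.of (Γ(X, V.1) ⧸ K))).inv := by
    rw [ΓSpecIso_inv_naturality, ← h4]
    have := Scheme.Hom.appLE_comp_appLE (Spec.map q) hV.fromSpec V.1 ⊤ ⊤ e1 le_top
    rw [← this]
    congr 1
  rw [h5, CommRingCat.comp_apply] at h3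
  have h6 : q s = 0 := by
    have := ConcreteCategory.bijective_of_isIso (ΓSpecIso (.of (Γ(X, V.1) ⧸ K))).inv
    exact this.1 (h3.trans (map_zero _).symm)
  exact Ideal.Quotient.eq_zero_iff_mem.1 h6

open Scheme IdealSheafData Limits in
/-- Over affine opens, the pulled back ideal sheaf is the extension of the given one. -/
theorem comap_ideal {X Y : Scheme.{u}} (I : Y.IdealSheafData) (f : X ⟶ Y) (U : Y.affineOpens)
    (V : X.affineOpens) (e : V.1 ≤ f ⁻¹ᵁ U.1) :
    (I.comap f).ideal V = (I.ideal U).map (f.appLE U V e).hom := by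
  refine le_antisymm (comap_ideal_le I f U V e) ?_
  rw [Ideal.map_le_iff_le_comap]
  intro s hs
  rw [Ideal.mem_comap, IdealSheafData.comap, Hom.ker_apply, RingHom.mem_ker]
  have e' : pullback.fst f I.subschemeι ⁻¹ᵁ V.1 ≤ pullback.snd f I.subschemeι ⁻¹ᵁ
      (I.subschemeι ⁻¹ᵁ U.1) := by
    rw [← Scheme.Hom.comp_preimage, ← pullback.condition]
    exact fun x hx => e hx
  have h0 : I.subschemeι.app U.1 s = 0 := by
    rw [← I.ker_subschemeι_app U] at hs
    exact hs
  have h1 : f.appLE U V e ≫ (pullback.fst f I.subschemeι).app V.1 =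
      I.subschemeι.app U.1 ≫ (pullback.snd f I.subschemeι).appLE _ _ e' := by
    rw [Scheme.Hom.app_eq_appLE, Scheme.Hom.app_eq_appLE, Scheme.Hom.appLE_comp_appLE,
      Scheme.Hom.appLE_comp_appLE]
    congr 1
    exact pullback.condition
  have := ConcreteCategory.congr_hom h1 s
  rw [CommRingCat.comp_apply, CommRingCat.comp_apply, h0, map_zero] at this
  exact this

/-! ### Change of coefficients and flatness on charts -/

section Chart

variable {A B : Type u} [CommRing A] [CommRing B]

theorem map_mem_grading (φ : A →+* B) {f : MvPolynomial (Fin 4) A} {d : ℕ} (hf : f ∈ grading A d) :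
    MvPolynomial.map φ f ∈ grading B d :=
  (coeffMap φ).map_mem hf

theorem away_map_dehom (φ : A →+* B) {f : MvPolynomial (Fin 4) A} (hf : f ∈ grading A 1)
    (n : MvPolynomial (Fin 4) A) :
    Away.map (coeffMap φ) f (dehom f hf n) =
      dehom (MvPolynomial.map φ f) (map_mem_grading φ hf) (MvPolynomial.map φ n) := by
  induction n using MvPolynomial.induction_on' with
  | monomial m a =>
    have hm : (monomial m a).IsHomogeneous m.degree := isHomogeneous_monomial _ rfl
    have hm1 : monomial m a ∈ grading A (m.degree • 1) := by simpa using mem_grading.2 hm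
    rw [dehom_eq_mk hf hm1, Away.map_mk]
    exact (dehom_eq_mk (map_mem_grading φ hf) (map_mem_grading φ hm1)).symm
  | add p q hp hq => rw [map_add, map_add, map_add, map_add, hp, hq]; rfl

theorem appLE_chartHom (φ : A →+* B) {f : MvPolynomial (Fin 4) A} (hf : f ∈ grading A 1)
    (n : MvPolynomial (Fin 4) A) :
    (P3.map φ).appLE (chart f hf).1 (chart (MvPolynomial.map φ f) (map_mem_grading φ hf)).1 le_rfl
      (chartHom f hf n) =
      chartHom (MvPolynomial.map φ f) (map_mem_grading φ hf) (MvPolynomial.map φ n) := by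
  have h := ConcreteCategory.congr_hom
    (Proj.awayToSection_comp_appLE (coeffMap φ) (irrelevant_le_map_coeffMap φ) hf) (dehom f hf n)
  exact h.trans (congrArg (awaySection (MvPolynomial.map φ f) (map_mem_grading φ hf))
    (away_map_dehom φ hf n))

/-- On charts, pulling back along a change of coefficients maps the defining ideal. -/
theorem comap_ideal_chart (φ : A →+* B) {f : MvPolynomial (Fin 4) A} (hf : f ∈ grading A 1)
    {S : (P3 A).IdealSheafData} {J : Ideal (MvPolynomial (Fin 4) A)}
    (hS : S.ideal (chart f hf) = J.map (chartHom f hf)) :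
    (S.comap (P3.map φ)).ideal (chart (MvPolynomial.map φ f) (map_mem_grading φ hf)) =
      (J.map (MvPolynomial.map φ)).map
        (chartHom (MvPolynomial.map φ f) (map_mem_grading φ hf)) := by
  rw [comap_ideal S (P3.map φ) (chart f hf) _ le_rfl, hS, Ideal.map_map, Ideal.map_map]
  congr 1
  exact RingHom.ext fun n => appLE_chartHom φ hf n

/-- The charts of linear forms that generate the irrelevant ideal cover `ℙ³`. -/
theorem iSup_chart_eq_top {b : Fin 4 → MvPolynomial (Fin 4) A} (hb : ∀ i, b i ∈ grading A 1)
    (hspan : ∀ j, X j ∈ Ideal.span (Set.range b)) : ⨆ i, (chart (b i) (hb i)).1 = ⊤ := by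
  refine Proj.iSup_basicOpen_eq_top (grading A) b ?_
  refine (HomogeneousIdeal.toIdeal_irrelevant_le _).2 fun i hi x hx => ?_
  have hx' : x.IsHomogeneous i := mem_grading.1 hx
  have h1 : x ∈ Ideal.span (X '' (Set.univ : Set (Fin 4)) : Set (MvPolynomial (Fin 4) A)) := by
    rw [mem_ideal_span_X_image]
    intro m hm
    by_contra! hcon
    have hm0 : m = 0 := Finsupp.ext fun j => hcon j (Set.mem_univ j)
    have := hx' (mem_support_iff.1 hm)
    simp [hm0] at this
    omega
  refine Ideal.span_le.2 ?_ h1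
  rintro _ ⟨j, -, rfl⟩
  exact hspan j

theorem sheaf_ext {b : Fin 4 → MvPolynomial (Fin 4) A} (hb : ∀ i, b i ∈ grading A 1)
    (hspan : ∀ j, X j ∈ Ideal.span (Set.range b)) {S T : (P3 A).IdealSheafData}
    (h : ∀ i, S.ideal (chart (b i) (hb i)) = T.ideal (chart (b i) (hb i))) : S = T :=
  Scheme.IdealSheafData.ext_of_iSup_eq_top _ (iSup_chart_eq_top hb hspan) h

theorem dehom_C {f : MvPolynomial (Fin 4) A} (hf : f ∈ grading A 1) (a : A) :
    dehom f hf (C a) = fromZeroRingHom (grading A) (Submonoid.powers f)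
      (algebraMap A (grading A 0) a) := by
  simp [dehom]

/-- In a chart, the structure morphism of `ℙ³` is the inclusion of the constants. -/
theorem fromSpec_toSpec {f : MvPolynomial (Fin 4) A} (hf : f ∈ grading A 1) :
    IsAffineOpen.fromSpec (chart f hf).2 ≫ P3.toSpec A =
      Spec.map (CommRingCat.ofHom ((chartHom f hf).comp C)) := by
  have hU : IsAffineOpen (Proj.basicOpen (grading A) f) :=
    Proj.isAffineOpen_basicOpen (grading A) f hf one_pos
  have h1 : hU.fromSpec =
      Spec.map (Proj.awayToSection (grading A) f) ≫ Proj.awayι (grading A) f hf one_pos := by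
    rw [← cancel_epi hU.isoSpec.hom, hU.isoSpec_hom, hU.toSpecΓ_fromSpec,
      ← Proj.basicOpenIsoSpec_inv_ι, ← Category.assoc]
    change _ = Proj.basicOpenToSpec (grading A) f ≫ _
    rw [← Proj.basicOpenIsoSpec_hom (grading A) f hf one_pos, Iso.hom_inv_id_assoc]
  change hU.fromSpec ≫ _ = _
  rw [h1, P3.toSpec, Category.assoc, Proj.awayι_toSpecZero_assoc, ← Spec.map_comp,
    ← Spec.map_comp]
  congr 1
  ext a
  exact congrArg (awaySection f hf) (dehom_C hf a).symm

/-- Over a Dedekind domain, a closed subscheme of `ℙ³` defined by a homogeneous ideal with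
torsion-free quotient is flat. -/
theorem flat_of_torsionFree [IsDedekindDomain A] {b : Fin 4 → MvPolynomial (Fin 4) A}
    (hb : ∀ i, b i ∈ grading A 1) (hspan : ∀ j, X j ∈ Ideal.span (Set.range b))
    {S : (P3 A).IdealSheafData} {J : Ideal (MvPolynomial (Fin 4) A)}
    (hJ : J.IsHomogeneous (grading A))
    (hS : ∀ i, S.ideal (chart (b i) (hb i)) = J.map (chartHom (b i) (hb i)))
    (htf : ∀ a n, a ≠ 0 → C a * n ∈ J → n ∈ J) :
    Flat (S.subschemeι ≫ P3.toSpec A) := by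
  have himm (U : (P3 A).affineOpens) : IsOpenImmersion (S.subschemeCover.f U) :=
    S.subschemeCover.map_prop U
  have htop : ⨆ i, (S.subschemeCover.f (chart (b i) (hb i))).opensRange = ⊤ := by
    have h1 := iSup_chart_eq_top hb hspan
    have h2 : S.subschemeι ⁻¹ᵁ (⨆ i, (chart (b i) (hb i)).1) = ⊤ := by rw [h1]; rfl
    rw [Scheme.Hom.preimage_iSup] at h2
    simpa only [Scheme.IdealSheafData.opensRange_subschemeCover_map] using h2
  have hloc : IsZariskiLocalAtSource @Flat.{u} :=
    HasRingHomProperty.instIsZariskiLocalAtSource (Q := RingHom.Flat)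
  rw [IsZariskiLocalAtSource.iff_of_iSup_eq_top (P := @Flat) _ htop]
  intro i
  let U := chart (b i) (hb i)
  let g := S.subschemeCover.f U
  have hg : g.opensRange.ι = g.isoOpensRange.inv ≫ g := by
    rw [Iso.eq_inv_comp]
    exact Scheme.Hom.isoOpensRange_hom_ι g
  change Flat (g.opensRange.ι ≫ _)
  rw [hg, Category.assoc]
  suffices Flat (g ≫ S.subschemeι ≫ P3.toSpec A) from inferInstance
  have hcomp : g ≫ S.subschemeι ≫ P3.toSpec A =
      Spec.map (CommRingCat.ofHom ((Ideal.Quotient.mk (S.ideal U)).comp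
        ((chartHom (b i) (hb i)).comp C))) := by
    rw [CommRingCat.ofHom_comp, Spec.map_comp, ← fromSpec_toSpec, ← Category.assoc,
      ← Category.assoc]
    congr 1
    exact (S.subschemeCover_map_subschemeι U).trans (S.glueDataObjι_ι U)
  rw [hcomp]
  refine Flat.SpecMap_iff.2 ?_
  let ρ := (Ideal.Quotient.mk (S.ideal U)).comp ((chartHom (b i) (hb i)).comp C)
  change ρ.Flat
  let := ρ.toAlgebra
  have : Module.IsTorsionFree A (Γ(P3 A, U.1) ⧸ S.ideal U) := by
    rw [Module.isTorsionFree_iff_smul_eq_zero]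
    intro a z haz
    by_contra! hcon
    obtain ⟨z, rfl⟩ := Ideal.Quotient.mk_surjective z
    obtain ⟨d, n, hn, rfl⟩ := exists_chartHom_eq (hb i) z
    have h1 : chartHom (b i) (hb i) (C a * n) ∈ J.map (chartHom (b i) (hb i)) := by
      rw [← hS i, ← Ideal.Quotient.eq_zero_iff_mem, map_mul, map_mul]
      exact haz
    have hCn : (C a * n).IsHomogeneous d := by simpa using (isHomogeneous_C _ a).mul hn
    obtain ⟨e, he⟩ := (chartHom_mem_map_iff (hb i) hJ hCn).1 h1
    rw [mul_left_comm] at he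
    refine hcon.2 (Ideal.Quotient.eq_zero_iff_mem.2 ?_)
    rw [hS i]
    exact (chartHom_mem_map_iff (hb i) hJ hn).2 ⟨e, htf a _ hcon.1 he⟩
  exact (inferInstance : Module.Flat A (Γ(P3 A, U.1) ⧸ S.ideal U))

end Chart

/-! ### Lines as graphs -/

section LineIdeal

variable {A B : Type u} [CommRing A] [CommRing B]

/-- The parameters of a line in `ℙ³` disjoint from the line `X₁ = X₂ = 0`: it is given by
`X₀ = u X₁ + v X₂` and `X₃ = a X₁ + b X₂`. -/
@[ext]
structure LineParam (A : Type u) where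
  /-- coefficient of `X₁` in `X₀` -/
  u : A
  /-- coefficient of `X₂` in `X₀` -/
  v : A
  /-- coefficient of `X₁` in `X₃` -/
  a : A
  /-- coefficient of `X₂` in `X₃` -/
  b : A

namespace LineParam

/-- Change of coefficients. -/
def map (φ : A →+* B) (p : LineParam A) : LineParam B := ⟨φ p.u, φ p.v, φ p.a, φ p.b⟩

/-- The linear form `X₀ - u X₁ - v X₂`. -/
noncomputable def form₀ (p : LineParam A) : MvPolynomial (Fin 4) A :=
  X 0 - C p.u * X 1 - C p.v * X 2

/-- The linear form `X₃ - a X₁ - b X₂`. -/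
noncomputable def form₃ (p : LineParam A) : MvPolynomial (Fin 4) A :=
  X 3 - C p.a * X 1 - C p.b * X 2

/-- The substitution `X₀ ↦ u X₁ + v X₂`, `X₃ ↦ a X₁ + b X₂`, which restricts polynomials to the
line. -/
noncomputable def subst (p : LineParam A) :
    MvPolynomial (Fin 4) A →ₐ[A] MvPolynomial (Fin 4) A :=
  aeval ![C p.u * X 1 + C p.v * X 2, X 1, X 2, C p.a * X 1 + C p.b * X 2]

/-- The ideal of the line. -/
noncomputable def ideal (p : LineParam A) : Ideal (MvPolynomial (Fin 4) A) :=
  RingHom.ker p.subst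

/-- The determinant that vanishes if and only if two lines meet. -/
def det (p q : LineParam A) : A := (p.u - q.u) * (p.b - q.b) - (p.v - q.v) * (p.a - q.a)

variable (p q : LineParam A)

theorem mem_ideal {f : MvPolynomial (Fin 4) A} : f ∈ p.ideal ↔ p.subst f = 0 := RingHom.mem_ker

@[simp] theorem subst_X0 : p.subst (X 0) = C p.u * X 1 + C p.v * X 2 := by simp [subst]
@[simp] theorem subst_X1 : p.subst (X 1) = X 1 := by simp [subst]
@[simp] theorem subst_X2 : p.subst (X 2) = X 2 := by simp [subst]
@[simp] theorem subst_X3 : p.subst (X 3) = C p.a * X 1 + C p.b * X 2 := by simp [subst]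
@[simp] theorem subst_C (c : A) : p.subst (C c) = C c := p.subst.commutes c

theorem form₀_mem : p.form₀ ∈ p.ideal := by simp [mem_ideal, form₀]
theorem form₃_mem : p.form₃ ∈ p.ideal := by simp [mem_ideal, form₃]

theorem ideal_eq_span : p.ideal = Ideal.span {p.form₀, p.form₃} := by
  refine le_antisymm (fun f hf => ?_) ?_
  · let S : Ideal (MvPolynomial (Fin 4) A) := Ideal.span {p.form₀, p.form₃}
    have h0 : Ideal.Quotient.mk S p.form₀ = 0 :=
      Ideal.Quotient.eq_zero_iff_mem.2 (Ideal.subset_span (by simp))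
    have h3 : Ideal.Quotient.mk S p.form₃ = 0 :=
      Ideal.Quotient.eq_zero_iff_mem.2 (Ideal.subset_span (by simp))
    have h : (Ideal.Quotient.mkₐ A S).comp p.subst = Ideal.Quotient.mkₐ A S := by
      ext i
      fin_cases i
      · rw [form₀, map_sub, map_sub, sub_sub, sub_eq_zero, ← map_add] at h0
        simpa using h0.symm
      · simp
      · simp
      · rw [form₃, map_sub, map_sub, sub_sub, sub_eq_zero, ← map_add] at h3
        simpa using h3.symm
    have h' := DFunLike.congr_fun h f
    rw [AlgHom.comp_apply, p.mem_ideal.1 hf, map_zero] at h'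
    exact Ideal.Quotient.eq_zero_iff_mem.1 h'.symm
  · rw [Ideal.span_le]
    rintro _ (rfl | rfl)
    exacts [p.form₀_mem, p.form₃_mem]

theorem isHomogeneous_form₀ : p.form₀.IsHomogeneous 1 :=
  ((isHomogeneous_X A 0).sub (by simpa using (isHomogeneous_C _ p.u).mul (isHomogeneous_X A 1))).sub
    (by simpa using (isHomogeneous_C _ p.v).mul (isHomogeneous_X A 2))

theorem isHomogeneous_form₃ : p.form₃.IsHomogeneous 1 :=
  ((isHomogeneous_X A 3).sub (by simpa using (isHomogeneous_C _ p.a).mul (isHomogeneous_X A 1))).sub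
    (by simpa using (isHomogeneous_C _ p.b).mul (isHomogeneous_X A 2))

theorem isHomogeneous_ideal : p.ideal.IsHomogeneous (grading A) := by
  rw [ideal_eq_span]
  refine Ideal.homogeneous_span _ _ ?_
  rintro _ (rfl | rfl)
  exacts [⟨1, mem_grading.2 p.isHomogeneous_form₀⟩, ⟨1, mem_grading.2 p.isHomogeneous_form₃⟩]

theorem isPrime_ideal [IsDomain A] : p.ideal.IsPrime := RingHom.ker_isPrime _

theorem mem_ideal_of_C_mul_mem [IsDomain A] {c : A} (hc : c ≠ 0) {f : MvPolynomial (Fin 4) A}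
    (h : C c * f ∈ p.ideal) : f ∈ p.ideal := by
  rw [mem_ideal, map_mul, subst_C] at h
  exact p.mem_ideal.2 ((mul_eq_zero.1 h).resolve_left (by simpa using hc))

theorem map_form₀ (φ : A →+* B) : MvPolynomial.map φ p.form₀ = (p.map φ).form₀ := by
  simp [form₀, map]

theorem map_form₃ (φ : A →+* B) : MvPolynomial.map φ p.form₃ = (p.map φ).form₃ := by
  simp [form₃, map]

theorem map_ideal (φ : A →+* B) : p.ideal.map (MvPolynomial.map φ) = (p.map φ).ideal := by
  rw [ideal_eq_span, ideal_eq_span, Ideal.map_span, Set.image_pair, map_form₀, map_form₃]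

/-- Two lines with nonzero determinant have no common point. -/
theorem X_mem_ideal_sup {k : Type u} [Field k] {p q : LineParam k} (h : p.det q ≠ 0) (c : Fin 4) :
    X c ∈ p.ideal ⊔ q.ideal := by
  set S := p.ideal ⊔ q.ideal
  have hp0 : p.form₀ ∈ S := Ideal.mem_sup_left p.form₀_mem
  have hp3 : p.form₃ ∈ S := Ideal.mem_sup_left p.form₃_mem
  have hq0 : q.form₀ ∈ S := Ideal.mem_sup_right q.form₀_mem
  have hq3 : q.form₃ ∈ S := Ideal.mem_sup_right q.form₃_mem
  have hCC : C (p.det q)⁻¹ * C (p.det q) = (1 : MvPolynomial (Fin 4) k) := by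
    rw [← C_mul, inv_mul_cancel₀ h, C_1]
  have h1 : (X 1 : MvPolynomial (Fin 4) k) ∈ S := by
    have : (X 1 : MvPolynomial (Fin 4) k) = C (p.det q)⁻¹ *
        (C (p.b - q.b) * (q.form₀ - p.form₀) - C (p.v - q.v) * (q.form₃ - p.form₃)) := by
      have : C (p.b - q.b) * (q.form₀ - p.form₀) - C (p.v - q.v) * (q.form₃ - p.form₃) =
          C (p.det q) * X 1 := by
        simp only [form₀, form₃, det, C_sub, C_mul]
        ring
      rw [this, ← mul_assoc, hCC, one_mul]
    rw [this]
    exact S.mul_mem_left _ (S.sub_mem (S.mul_mem_left _ (S.sub_mem hq0 hp0))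
      (S.mul_mem_left _ (S.sub_mem hq3 hp3)))
  have h2 : (X 2 : MvPolynomial (Fin 4) k) ∈ S := by
    have : (X 2 : MvPolynomial (Fin 4) k) = C (p.det q)⁻¹ *
        (C (p.u - q.u) * (q.form₃ - p.form₃) - C (p.a - q.a) * (q.form₀ - p.form₀)) := by
      have : C (p.u - q.u) * (q.form₃ - p.form₃) - C (p.a - q.a) * (q.form₀ - p.form₀) =
          C (p.det q) * X 2 := by
        simp only [form₀, form₃, det, C_sub, C_mul]
        ring
      rw [this, ← mul_assoc, hCC, one_mul]
    rw [this]
    exact S.mul_mem_left _ (S.sub_mem (S.mul_mem_left _ (S.sub_mem hq3 hp3))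
      (S.mul_mem_left _ (S.sub_mem hq0 hp0)))
  have h0 : (X 0 : MvPolynomial (Fin 4) k) ∈ S := by
    have : (X 0 : MvPolynomial (Fin 4) k) = p.form₀ + C p.u * X 1 + C p.v * X 2 := by
      simp only [form₀]; ring
    rw [this]
    exact S.add_mem (S.add_mem hp0 (S.mul_mem_left _ h1)) (S.mul_mem_left _ h2)
  have h3 : (X 3 : MvPolynomial (Fin 4) k) ∈ S := by
    have : (X 3 : MvPolynomial (Fin 4) k) = p.form₃ + C p.a * X 1 + C p.b * X 2 := by
      simp only [form₃]; ring
    rw [this]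
    exact S.add_mem (S.add_mem hp3 (S.mul_mem_left _ h1)) (S.mul_mem_left _ h2)
  fin_cases c
  exacts [h0, h1, h2, h3]

end LineParam

end LineIdeal

/-! ### Products of linear forms and the fat point -/

section ProdIdeal

variable {S : Type*} [CommRing S] {ι : Type*} [DecidableEq ι]

/-- The ideal generated by the products of the `ℓ l`, `l ∈ T`, with `r` factors left out. -/
def prodIdeal (ℓ : ι → S) (r : ℕ) (T : Finset ι) : Ideal S :=
  Ideal.span ((fun E => ∏ l ∈ T \ E, ℓ l) '' {E | E ⊆ T ∧ E.card = r})

theorem mul_mem_prodIdeal {ℓ : ι → S} {r : ℕ} {T : Finset ι} {q h : S}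
    (hq : q ∈ Ideal.span (ℓ '' T)) (hh : ∀ l ∈ T, h ∈ prodIdeal ℓ r (T.erase l)) :
    q * h ∈ prodIdeal ℓ r T := by
  induction hq using Submodule.span_induction with
  | zero => simp
  | add x y _ _ hx hy => rw [add_mul]; exact add_mem hx hy
  | smul a x _ hx => rw [smul_eq_mul, mul_assoc]; exact Ideal.mul_mem_left _ _ hx
  | mem q hq =>
    obtain ⟨l, hl, rfl⟩ := hq
    have hl' : l ∈ T := hl
    have := hh l hl'
    rw [prodIdeal] at this
    clear hh
    induction this using Submodule.span_induction with
    | zero => simp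
    | add x y _ _ hx hy => rw [mul_add]; exact add_mem hx hy
    | smul a x _ hx => rw [smul_eq_mul, mul_left_comm]; exact Ideal.mul_mem_left _ _ hx
    | mem x hx =>
      obtain ⟨E, ⟨hE, hcard⟩, rfl⟩ := hx
      refine Ideal.subset_span ⟨E, ⟨hE.trans (Finset.erase_subset _ _), hcard⟩, ?_⟩
      have hlE : l ∉ E := fun h => Finset.notMem_erase l T (hE h)
      have : T \ E = insert l (T.erase l \ E) := by
        ext j
        simp only [Finset.mem_sdiff, Finset.mem_insert, Finset.mem_erase]
        constructor
        · rintro ⟨h1, h2⟩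
          by_cases hj : j = l
          · exact Or.inl hj
          · exact Or.inr ⟨⟨hj, h1⟩, h2⟩
        · rintro (rfl | ⟨⟨_, h1⟩, h2⟩)
          exacts [⟨hl', hlE⟩, ⟨h1, h2⟩]
      simp only [this]
      rw [Finset.prod_insert (by simp)]

/-- Distinct lines `X₀ = mₗ X₁` through a point: the products of all but one of their equations
generate a power of the ideal of that point. -/
theorem X_pow_mul_X_pow_mem_prodIdeal {k : Type*} [Field k] {m : ι → k}
    (hm : Function.Injective m) (n : ℕ) (T : Finset ι) (hT : T.card = n + 1) (α β : ℕ)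
    (hαβ : α + β = n) :
    (X 0 ^ α * X 1 ^ β : MvPolynomial (Fin 4) k) ∈
      prodIdeal (fun l => X 0 - C (m l) * X 1) 1 T := by
  induction n generalizing T α β with
  | zero =>
    obtain ⟨rfl, rfl⟩ : α = 0 ∧ β = 0 := by omega
    exact Ideal.subset_span ⟨T, ⟨le_rfl, hT⟩, by simp⟩
  | succ n ih =>
    set ℓ : ι → MvPolynomial (Fin 4) k := fun l => X 0 - C (m l) * X 1
    obtain ⟨a, ha, b, hb, hab⟩ := Finset.one_lt_card.1 (by omega : 1 < T.card)
    have hCC : C (m a - m b)⁻¹ * (C (m a) - C (m b)) = (1 : MvPolynomial (Fin 4) k) := by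
      rw [← C_sub, ← C_mul, inv_mul_cancel₀ (sub_ne_zero.2 (hm.ne hab)), C_1]
    have hla : ℓ a ∈ Ideal.span (ℓ '' T) := Ideal.subset_span ⟨a, ha, rfl⟩
    have hlb : ℓ b ∈ Ideal.span (ℓ '' T) := Ideal.subset_span ⟨b, hb, rfl⟩
    have h0 : (X 0 : MvPolynomial (Fin 4) k) ∈ Ideal.span (ℓ '' T) := by
      have : (X 0 : MvPolynomial (Fin 4) k) =
          C (m a - m b)⁻¹ * (C (m a) * ℓ b - C (m b) * ℓ a) := by
        linear_combination (-X 0 : MvPolynomial (Fin 4) k) * hCC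
      rw [this]
      exact Ideal.mul_mem_left _ _
        (sub_mem (Ideal.mul_mem_left _ _ hlb) (Ideal.mul_mem_left _ _ hla))
    have h1 : (X 1 : MvPolynomial (Fin 4) k) ∈ Ideal.span (ℓ '' T) := by
      have : (X 1 : MvPolynomial (Fin 4) k) = C (m a - m b)⁻¹ * (ℓ b - ℓ a) := by
        linear_combination (-X 1 : MvPolynomial (Fin 4) k) * hCC
      rw [this]
      exact Ideal.mul_mem_left _ _ (sub_mem hlb hla)
    have hcard : ∀ l ∈ T, (T.erase l).card = n + 1 := fun l hl => by
      rw [Finset.card_erase_of_mem hl]; omega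
    rcases Nat.eq_zero_or_pos α with rfl | hα
    · obtain rfl : β = n + 1 := by omega
      rw [pow_succ', mul_left_comm]
      exact mul_mem_prodIdeal h1 fun l hl => ih _ (hcard l hl) 0 n (by omega)
    · obtain ⟨α, rfl⟩ : ∃ α', α = α' + 1 := ⟨α - 1, by omega⟩
      rw [pow_succ', mul_assoc]
      exact mul_mem_prodIdeal h0 fun l hl => ih _ (hcard l hl) α β (by omega)

/-- Lines in the plane with coordinates `X₀, X₁, X₂`, no three of them concurrent: up to a constant
of the base ring, the products of all but two of their equations generate a power of `X₂`. -/
theorem exists_C_mul_X_pow_mem_prodIdeal {A : Type*} [CommRing A] [IsDomain A] {U V : ι → A}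
    (hUV : ∀ a b c, a ≠ b → b ≠ c → c ≠ a →
      (U b - U c) * V a + (U c - U a) * V b + (U a - U b) * V c ≠ 0)
    (n : ℕ) (T : Finset ι) (hT : T.card = n + 2) :
    ∃ D : A, D ≠ 0 ∧ (C D * X 2 ^ n : MvPolynomial (Fin 4) A) ∈
      prodIdeal (fun l => X 0 - C (U l) * X 1 - C (V l) * X 2) 2 T := by
  induction n generalizing T with
  | zero =>
    refine ⟨1, one_ne_zero, Ideal.subset_span ⟨T, ⟨le_rfl, hT⟩, by simp⟩⟩
  | succ n ih =>
    set ℓ : ι → MvPolynomial (Fin 4) A := fun l => X 0 - C (U l) * X 1 - C (V l) * X 2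
    obtain ⟨a, b, c, ha, hb, hc, hab, hac, hbc⟩ := Finset.two_lt_card_iff.1 (by omega : 2 < T.card)
    have hcard : ∀ l ∈ T, (T.erase l).card = n + 2 := fun l hl => by
      rw [Finset.card_erase_of_mem hl]; omega
    choose! D hD0 hD using fun l (hl : l ∈ T) => ih _ (hcard l hl)
    set Δ : A := (U b - U c) * V a + (U c - U a) * V b + (U a - U b) * V c
    refine ⟨Δ * ∏ l ∈ T, D l, mul_ne_zero (hUV a b c hab hbc hac.symm)
      (Finset.prod_ne_zero_iff.2 hD0), ?_⟩
    have hq : C Δ * X 2 ∈ Ideal.span (ℓ '' T) := by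
      have : C Δ * X 2 = -(C (U b - U c) * ℓ a + C (U c - U a) * ℓ b + C (U a - U b) * ℓ c) := by
        simp only [Δ, ℓ, C_sub, C_add, C_mul]
        ring
      rw [this]
      exact neg_mem (add_mem (add_mem (Ideal.mul_mem_left _ _ (Ideal.subset_span ⟨a, ha, rfl⟩))
        (Ideal.mul_mem_left _ _ (Ideal.subset_span ⟨b, hb, rfl⟩)))
        (Ideal.mul_mem_left _ _ (Ideal.subset_span ⟨c, hc, rfl⟩)))
    have hfin := mul_mem_prodIdeal (h := C (∏ l ∈ T, D l) * X 2 ^ n) hq fun l hl => by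
      rw [← Finset.prod_erase_mul _ _ hl, C_mul, mul_assoc]
      exact Ideal.mul_mem_left _ _ (hD l hl)
    convert hfin using 1
    rw [C_mul, pow_succ]
    ring

end ProdIdeal

section FatPoint

variable {k : Type*} [CommRing k]

/-- The ideal `(X₀, X₁, X₃) ^ s + (X₃) ^ 2`, which defines the first order neighbourhood in the
plane `X₃ = 0` of its `s`-fold point `X₀ = X₁ = X₃ = 0`. -/
noncomputable def fatPointIdeal (k : Type*) [CommRing k] (s : ℕ) : Ideal (MvPolynomial (Fin 4) k) :=
  Ideal.span {X 0, X 1, X 3} ^ s ⊔ Ideal.span {X 3} ^ 2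

theorem monomial_mem_fatPointIdeal {s : ℕ} {m : Fin 4 →₀ ℕ}
    (hm : 2 ≤ m 3 ∨ s ≤ m 0 + m 1 + m 3) (c : k) : monomial m c ∈ fatPointIdeal k s := by
  have h0 : (X 0 : MvPolynomial (Fin 4) k) ∈ Ideal.span {X 0, X 1, X 3} :=
    Ideal.subset_span (by simp)
  have h1 : (X 1 : MvPolynomial (Fin 4) k) ∈ Ideal.span {X 0, X 1, X 3} :=
    Ideal.subset_span (by simp)
  have h3 : (X 3 : MvPolynomial (Fin 4) k) ∈ Ideal.span {X 0, X 1, X 3} :=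
    Ideal.subset_span (by simp)
  have h3' : (X 3 : MvPolynomial (Fin 4) k) ∈ Ideal.span {X 3} := Ideal.subset_span rfl
  rw [monomial_eq, Finsupp.prod_fintype _ _ (by simp), Fin.prod_univ_four]
  refine Ideal.mul_mem_left _ _ ?_
  rcases hm with h | h
  · exact Ideal.mul_mem_left _ _ (Ideal.mem_sup_right
      (Ideal.pow_le_pow_right h (Ideal.pow_mem_pow h3' (m 3))))
  · refine Ideal.mem_sup_left (Ideal.pow_le_pow_right h ?_)
    rw [mul_right_comm]
    refine Ideal.mul_mem_right _ _ ?_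
    rw [pow_add, pow_add]
    exact Ideal.mul_mem_mul (Ideal.mul_mem_mul (Ideal.pow_mem_pow h0 (m 0))
      (Ideal.pow_mem_pow h1 (m 1))) (Ideal.pow_mem_pow h3 (m 3))

theorem of_mem_fatPointIdeal {s : ℕ} {g : MvPolynomial (Fin 4) k}
    (hg : g ∈ fatPointIdeal k s) {m : Fin 4 →₀ ℕ} (hm : m ∈ g.support) :
    2 ≤ m 3 ∨ s ≤ m 0 + m 1 + m 3 := by
  -- `M n` is the monomial ideal of order at least `n` along `X₀ = X₁ = X₃ = 0`.
  let M (n : ℕ) : Ideal (MvPolynomial (Fin 4) k) :=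
    Ideal.span ((fun m => monomial m 1) '' {m : Fin 4 →₀ ℕ | n ≤ m 0 + m 1 + m 3})
  have hX (i : Fin 4) (hi : i = 0 ∨ i = 1 ∨ i = 3) : (X i : MvPolynomial (Fin 4) k) ∈ M 1 := by
    refine Ideal.subset_span ⟨Finsupp.single i 1, ?_, rfl⟩
    rcases hi with rfl | rfl | rfl <;> simp
  have hM (n : ℕ) : Ideal.span {X 0, X 1, X 3} ^ n ≤ M n := by
    induction n with
    | zero =>
      have : (1 : MvPolynomial (Fin 4) k) ∈ M 0 := Ideal.subset_span ⟨0, by simp, rfl⟩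
      rw [(Ideal.eq_top_iff_one _).2 this]
      exact le_top
    | succ n ih =>
      have h1 : Ideal.span {X 0, X 1, X 3} ≤ M 1 := by
        rw [Ideal.span_le]
        rintro _ (rfl | rfl | rfl)
        exacts [hX 0 (by simp), hX 1 (by simp), hX 3 (by simp)]
      rw [pow_succ]
      refine (Ideal.mul_mono ih h1).trans ?_
      rw [Ideal.span_mul_span', Ideal.span_le]
      rintro _ ⟨_, ⟨a, ha, rfl⟩, _, ⟨b, hb, rfl⟩, rfl⟩
      refine Ideal.subset_span ⟨a + b, ?_, by simp [monomial_mul]⟩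
      simp only [Set.mem_ofPred_eq, Finsupp.add_apply] at ha hb ⊢
      omega
  let N : Ideal (MvPolynomial (Fin 4) k) :=
    Ideal.span ((fun m => monomial m 1) '' {m : Fin 4 →₀ ℕ | 2 ≤ m 3 ∨ s ≤ m 0 + m 1 + m 3})
  have hN : fatPointIdeal k s ≤ N := by
    refine sup_le ((hM s).trans (Ideal.span_mono (Set.image_mono fun m hm => Or.inr hm))) ?_
    rw [Ideal.span_singleton_pow, Ideal.span_singleton_le_iff_mem]
    refine Ideal.subset_span ⟨Finsupp.single 3 2, by simp, ?_⟩
    rw [X_pow_eq_monomial]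
  obtain ⟨m', hm', hle⟩ := mem_ideal_span_monomial_image.1 (hN hg) m hm
  have h0 := hle 0
  have h1 := hle 1
  have h3 := hle 3
  rcases hm' with h | h
  · exact Or.inl (h.trans h3)
  · exact Or.inr (by omega)

end FatPoint

/-! ### The family of moving lines -/

section Family

variable {k : Type u} [Field k]

/-- The line moving with the parameter `λ` (the variable of `k[λ]`) from the line
`X₀ = m X₁`, `X₃ = 0` at `λ = 0` to the line with parameters `p` at `λ = 1`. The exponent `N` makes
it approach the plane `X₃ = 0` fast compared to its movement in the directions of the plane. -/
noncomputable def movingLine (m : k) (p : LineParam k) (N : ℕ) : LineParam (Polynomial k) where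
  u := Polynomial.C m + Polynomial.X * Polynomial.C (p.u - m)
  v := Polynomial.X * (Polynomial.C (m ^ 2) + Polynomial.X * Polynomial.C (p.v - m ^ 2))
  a := Polynomial.X ^ N * Polynomial.C p.a
  b := Polynomial.X ^ N * Polynomial.C p.b

theorem movingLine_eval_one (m : k) (p : LineParam k) (N : ℕ) :
    (movingLine m p N).map (Polynomial.evalRingHom 1) = p := by
  ext <;> simp [movingLine, LineParam.map]

theorem movingLine_eval_zero (m : k) (p : LineParam k) {N : ℕ} (hN : N ≠ 0) :
    (movingLine m p N).map (Polynomial.evalRingHom 0) = ⟨m, 0, 0, 0⟩ := by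
  ext <;> simp [movingLine, LineParam.map, hN]

variable {s : ℕ} (m : Fin s → k) (p : Fin s → LineParam k) (N : ℕ)

/-- The ideal of the union of the moving lines in `ℙ³ × 𝔸¹`. -/
noncomputable def totalIdeal : Ideal (MvPolynomial (Fin 4) (Polynomial k)) :=
  ⨅ i, (movingLine (m i) (p i) N).ideal

/-- The ideal of the fiber of the family of moving lines at `λ = c`, up to saturation. -/
noncomputable def fiberIdeal (c : k) : Ideal (MvPolynomial (Fin 4) k) :=
  (totalIdeal m p N).map (MvPolynomial.map (Polynomial.evalRingHom c))

theorem isHomogeneous_totalIdeal : (totalIdeal m p N).IsHomogeneous (grading (Polynomial k)) :=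
  Ideal.IsHomogeneous.iInf fun _ => LineParam.isHomogeneous_ideal _

theorem mem_totalIdeal_of_C_mul_mem {c : Polynomial k} (hc : c ≠ 0)
    {f : MvPolynomial (Fin 4) (Polynomial k)} (h : C c * f ∈ totalIdeal m p N) :
    f ∈ totalIdeal m p N :=
  Ideal.mem_iInf.2 fun i => LineParam.mem_ideal_of_C_mul_mem _ hc (Ideal.mem_iInf.1 h i)

theorem fiberIdeal_le (c : k) : fiberIdeal m p N c ≤
    ⨅ i, ((movingLine (m i) (p i) N).map (Polynomial.evalRingHom c)).ideal := by
  refine le_iInf fun i => ?_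
  rw [← LineParam.map_ideal]
  exact Ideal.map_mono (iInf_le _ i)

theorem prod_le_fiberIdeal (c : k) :
    ∏ i, ((movingLine (m i) (p i) N).map (Polynomial.evalRingHom c)).ideal ≤
      fiberIdeal m p N c := by
  simp_rw [← LineParam.map_ideal]
  refine (map_prod (Ideal.mapHom (MvPolynomial.map (Polynomial.evalRingHom c)))
    (fun i => (movingLine (m i) (p i) N).ideal) Finset.univ).symm.le.trans ?_
  refine Ideal.map_mono (Ideal.prod_le_inf.trans ?_)
  rw [totalIdeal, Finset.inf_univ_eq_iInf]

/-- The moving lines are pairwise disjoint for all but finitely many parameters, since they are so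
at `λ = 1`. -/
theorem finite_setOf_det_eq_zero (hp : ∀ i j, i ≠ j → (p i).det (p j) ≠ 0) :
    {c : k | ∃ i j, i ≠ j ∧ ((movingLine (m i) (p i) N).map (Polynomial.evalRingHom c)).det
      ((movingLine (m j) (p j) N).map (Polynomial.evalRingHom c)) = 0}.Finite := by
  have hmap (i j) (c : k) : ((movingLine (m i) (p i) N).map (Polynomial.evalRingHom c)).det
      ((movingLine (m j) (p j) N).map (Polynomial.evalRingHom c)) =
      ((movingLine (m i) (p i) N).det (movingLine (m j) (p j) N)).eval c := by
    simp [LineParam.det, LineParam.map]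
  have hne (i j) (hij : i ≠ j) :
      (movingLine (m i) (p i) N).det (movingLine (m j) (p j) N) ≠ 0 := fun h => by
    have := hmap i j 1
    rw [movingLine_eval_one, movingLine_eval_one, h, Polynomial.eval_zero] at this
    exact hp i j hij this
  refine (Set.finite_iUnion fun i => Set.finite_iUnion fun j => Set.finite_iUnion
    fun hij : i ≠ j => ?_ : (⋃ i, ⋃ j, ⋃ _ : i ≠ j,
      {c : k | ((movingLine (m i) (p i) N).det
        (movingLine (m j) (p j) N)).eval c = 0}).Finite).subset ?_
  · exact Polynomial.finite_setOfPred_isRoot (hne i j hij)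
  · rintro c ⟨i, j, hij, h⟩
    rw [hmap] at h
    exact Set.mem_iUnion.2 ⟨i, Set.mem_iUnion.2 ⟨j, Set.mem_iUnion.2 ⟨hij, h⟩⟩⟩

/-- The ideal of the cone configuration: the lines `X₀ = mᵢ X₁` in the plane `X₃ = 0` together
with the first order neighbourhood in the plane of the `s`-fold point where they meet. -/
noncomputable def coneIdeal : Ideal (MvPolynomial (Fin 4) k) :=
  (⨅ i, (⟨m i, 0, 0, 0⟩ : LineParam k).ideal) ⊓ fatPointIdeal k s

end Family

section LowerBound

variable {k : Type u} [Field k] {s : ℕ} {m : Fin s → k} {p : Fin s → LineParam k} {N : ℕ}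

/-- Modulo `λ ^ N`, the equation `X₃ = ⋯` of each moving line is `X₃ = 0`. Hence the products of
equations of the moving lines provide multiples of powers of `X₃` in the ideal of their union. -/
theorem exists_sub_mem_totalIdeal {r : ℕ} {q : MvPolynomial (Fin 4) (Polynomial k)}
    (hq : q ∈ prodIdeal (fun i => (movingLine (m i) (p i) N).form₀) r Finset.univ) :
    ∃ q', X 3 ^ r * q - C (Polynomial.X ^ N) * q' ∈ totalIdeal m p N := by
  rw [prodIdeal] at hq
  induction hq using Submodule.span_induction with
  | zero => exact ⟨0, by simp⟩
  | add x y _ _ hx hy =>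
    obtain ⟨x', hx⟩ := hx
    obtain ⟨y', hy⟩ := hy
    refine ⟨x' + y', ?_⟩
    convert add_mem hx hy using 1
    ring
  | smul a x _ hx =>
    obtain ⟨x', hx⟩ := hx
    refine ⟨a * x', ?_⟩
    convert Ideal.mul_mem_left _ a hx using 1
    rw [smul_eq_mul]
    ring
  | mem x hx =>
    obtain ⟨E, ⟨-, rfl⟩, rfl⟩ := hx
    let t : MvPolynomial (Fin 4) (Polynomial k) := C (Polynomial.X ^ N)
    have hdvd : t ∣ X 3 ^ E.card - ∏ i ∈ E, (movingLine (m i) (p i) N).form₃ := by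
      rw [← Ideal.mem_span_singleton, ← Ideal.Quotient.eq_zero_iff_mem, map_sub, map_prod, map_pow,
        sub_eq_zero]
      refine Eq.trans (Finset.prod_const (M := _ ⧸ Ideal.span {t}) _).symm
        (Finset.prod_congr rfl fun i _ => ?_)
      rw [← sub_eq_zero, ← map_sub, Ideal.Quotient.eq_zero_iff_mem, Ideal.mem_span_singleton]
      refine ⟨C (Polynomial.C (p i).a) * X 1 + C (Polynomial.C (p i).b) * X 2, ?_⟩
      simp only [LineParam.form₃, movingLine, C_mul, t]
      ring
    obtain ⟨q', hq'⟩ := hdvd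
    refine ⟨q' * ∏ i ∈ Finset.univ \ E, (movingLine (m i) (p i) N).form₀, ?_⟩
    have : X 3 ^ E.card * ∏ i ∈ Finset.univ \ E, (movingLine (m i) (p i) N).form₀ -
        t * (q' * ∏ i ∈ Finset.univ \ E, (movingLine (m i) (p i) N).form₀) =
        (∏ i ∈ E, (movingLine (m i) (p i) N).form₃) *
          ∏ i ∈ Finset.univ \ E, (movingLine (m i) (p i) N).form₀ := by
      rw [← mul_assoc, ← hq']
      ring
    rw [this]
    refine Ideal.mem_iInf.2 fun i => ?_
    by_cases hi : i ∈ E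
    · exact Ideal.mul_mem_right _ _
        (Ideal.mem_of_dvd _ (Finset.dvd_prod_of_mem _ hi) (LineParam.form₃_mem _))
    · exact Ideal.mul_mem_left _ _ (Ideal.mem_of_dvd _
        (Finset.dvd_prod_of_mem (fun i => (movingLine (m i) (p i) N).form₀) (by simpa using hi))
        (LineParam.form₀_mem _))

/-- At `λ = 0`, the products of the equations of all but `r` of the plane lines become equations of
the special fiber after multiplication by `X₃ ^ r`. -/
theorem X_pow_mul_mem_fiberIdeal (hN : N ≠ 0) {r : ℕ} {q : MvPolynomial (Fin 4) k}
    (hq : q ∈ prodIdeal (fun i => X 0 - C (m i) * X 1) r Finset.univ) :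
    X 3 ^ r * q ∈ fiberIdeal m p N 0 := by
  rw [prodIdeal] at hq
  induction hq using Submodule.span_induction with
  | zero => simp
  | add x y _ _ hx hy => rw [mul_add]; exact add_mem hx hy
  | smul a x _ hx => rw [smul_eq_mul, mul_left_comm]; exact Ideal.mul_mem_left _ _ hx
  | mem x hx =>
    obtain ⟨E, hE, rfl⟩ := hx
    obtain ⟨q', hq'⟩ := exists_sub_mem_totalIdeal (m := m) (p := p) (N := N)
      (Ideal.subset_span ⟨E, hE, rfl⟩)
    have := Ideal.mem_map_of_mem (MvPolynomial.map (Polynomial.evalRingHom (0 : k))) hq'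
    rw [fiberIdeal]
    simpa [LineParam.form₀, movingLine, hN] using this

/-- The projections of the moving lines to the plane `X₃ = 0` are not concurrent for general `λ`,
and therefore `X₃²` vanishes on the part `X₂ ≠ 0` of the special fiber. -/
theorem exists_X_pow_mul_X_sq_mem_fiberIdeal (hs : 2 ≤ s) (hm : Function.Injective m) :
    ∃ N₀, ∀ N, N₀ ≤ N → X 2 ^ (s - 2) * X 3 ^ 2 ∈ fiberIdeal m p N 0 := by
  let U (i : Fin s) := (movingLine (m i) (p i) 0).u
  let V (i : Fin s) := (movingLine (m i) (p i) 0).v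
  have hUV : ∀ a b c, a ≠ b → b ≠ c → c ≠ a →
      (U b - U c) * V a + (U c - U a) * V b + (U a - U b) * V c ≠ 0 := by
    intro a b c hab hbc hca h
    -- To first order in `λ`, this is a Vandermonde determinant.
    have h1 := congrArg Polynomial.derivative h
    have h2 := congrArg (Polynomial.eval 0) h1
    simp [U, V, movingLine, Polynomial.derivative_pow] at h2
    have h3 : (m a - m b) * (m b - m c) * (m c - m a) = 0 := by linear_combination -h2
    simp [sub_eq_zero, hm.eq_iff, hab, hbc, hca] at h3
  obtain ⟨D, hD0, hD⟩ := exists_C_mul_X_pow_mem_prodIdeal hUV (s - 2) Finset.univ (by simp; omega)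
  -- Dividing by the power of `λ` in `D` needs `N` to be larger than the exponent.
  obtain ⟨D', hD', hDD'⟩ := Polynomial.exists_eq_pow_rootMultiplicity_mul_and_not_dvd D hD0 0
  rw [Polynomial.C_0, sub_zero] at hD' hDD'
  set e := D.rootMultiplicity 0
  refine ⟨e + 1, fun N hN => ?_⟩
  obtain ⟨q', hq'⟩ := exists_sub_mem_totalIdeal (m := m) (p := p) (N := N) hD
  have h1 : C (Polynomial.X ^ e) * (X 3 ^ 2 * (C D' * X 2 ^ (s - 2)) -
      C (Polynomial.X ^ (N - e)) * q') ∈ totalIdeal m p N := by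
    convert hq' using 1
    rw [hD', ← Nat.sub_add_cancel (by omega : e ≤ N), Nat.add_sub_cancel, pow_add]
    simp only [C_mul]
    ring
  have h2 := Ideal.mem_map_of_mem (MvPolynomial.map (Polynomial.evalRingHom (0 : k)))
    (mem_totalIdeal_of_C_mul_mem m p N (by simp) h1)
  have hD'0 : D'.eval 0 ≠ 0 := fun h => hDD' (Polynomial.X_dvd_iff.2
    (by rwa [Polynomial.coeff_zero_eq_eval_zero]))
  have h3 := Ideal.mul_mem_left _ (C (D'.eval 0)⁻¹) h2
  have hCC : C (D'.eval 0)⁻¹ * C (D'.eval 0) = (1 : MvPolynomial (Fin 4) k) := by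
    rw [← C_mul, inv_mul_cancel₀ hD'0, C_1]
  rw [fiberIdeal]
  convert h3 using 1
  have h0 : (0 : MvPolynomial (Fin 4) k) ^ (N - e) = 0 := zero_pow (by omega)
  simp only [map_sub, map_mul, map_pow, map_X, map_C, Polynomial.coe_evalRingHom,
    Polynomial.eval_X, map_zero, h0]
  linear_combination (-X 2 ^ (s - 2) * X 3 ^ 2 : MvPolynomial (Fin 4) k) * hCC

end LowerBound

/-! ### The special fiber is contained in the cone -/

section LowerBound

variable {k : Type u} [Field k] {s : ℕ} {m : Fin s → k} {p : Fin s → LineParam k} {N : ℕ}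

theorem isRelPrime_X_sub_C_mul_X {a b : k} (hab : a ≠ b) :
    IsRelPrime (X 0 - C a * X 1 : MvPolynomial (Fin 4) k) (X 0 - C b * X 1) := by
  intro d ha hb
  have hCC : C (b - a)⁻¹ * (C b - C a) = (1 : MvPolynomial (Fin 4) k) := by
    rw [← C_sub, ← C_mul, inv_mul_cancel₀ (sub_ne_zero.2 hab.symm), C_1]
  have h1 : d ∣ X 1 := by
    have : (X 1 : MvPolynomial (Fin 4) k) =
        C (b - a)⁻¹ * ((X 0 - C a * X 1) - (X 0 - C b * X 1)) := by
      linear_combination (-X 1 : MvPolynomial (Fin 4) k) * hCC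
    rw [this]
    exact Dvd.dvd.mul_left (dvd_sub ha hb) _
  have h0 : d ∣ X 0 := (dvd_sub_left (Dvd.dvd.mul_left h1 _)).1 ha
  rcases (X_prime (R := k) (i := (0 : Fin 4))).irreducible.dvd_iff.1 h0 with h | h
  · exact h
  · have := X_dvd_X.1 (h.dvd.trans h1)
    simp at this

/-- An equation of the cone is the product of the equations of its lines, up to a multiple of
`X₃`. -/
theorem exists_eq_prod_mul_add_of_mem_iInf (hm : Function.Injective m)
    {g : MvPolynomial (Fin 4) k} (hg : g ∈ ⨅ i, (⟨m i, 0, 0, 0⟩ : LineParam k).ideal) :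
    ∃ q r, g = (∏ i, (X 0 - C (m i) * X 1)) * q + X 3 * r := by
  let φ : MvPolynomial (Fin 4) k →ₐ[k] MvPolynomial (Fin 4) k := aeval ![X 0, X 1, X 2, 0]
  have hφ (f : MvPolynomial (Fin 4) k) : X 3 ∣ f - φ f := by
    rw [← Ideal.mem_span_singleton, ← Ideal.Quotient.mk_eq_mk_iff_sub_mem]
    have h3 : Ideal.Quotient.mk (Ideal.span {(X 3 : MvPolynomial (Fin 4) k)}) (X 3) = 0 :=
      Ideal.Quotient.eq_zero_iff_mem.2 (Ideal.subset_span rfl)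
    have : (Ideal.Quotient.mkₐ k (Ideal.span {(X 3 : MvPolynomial (Fin 4) k)})).comp φ =
        Ideal.Quotient.mkₐ k _ := by
      ext i
      fin_cases i <;> simp [φ, h3]
    exact (DFunLike.congr_fun this f).symm
  obtain ⟨r, hr⟩ := hφ g
  have hdvd : ∏ i, (X 0 - C (m i) * X 1) ∣ φ g := by
    refine Finset.prod_dvd_of_isRelPrime
      (fun i _ j _ hij => isRelPrime_X_sub_C_mul_X (hm.ne hij)) fun i _ => ?_
    have hi := Ideal.mem_iInf.1 hg i
    rw [LineParam.ideal_eq_span] at hi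
    obtain ⟨a, b, hab⟩ := Ideal.mem_span_pair.1 hi
    refine ⟨φ a, ?_⟩
    rw [← hab]
    simp [φ, LineParam.form₀, LineParam.form₃, mul_comm]
  obtain ⟨q, hq⟩ := hdvd
  exact ⟨q, r, by linear_combination hq + hr⟩

theorem prod_mul_mem_fatPointIdeal (m : Fin s → k) (q : MvPolynomial (Fin 4) k) :
    (∏ i, (X 0 - C (m i) * X 1)) * q ∈ fatPointIdeal k s := by
  refine Ideal.mul_mem_right _ _ (Ideal.mem_sup_left ?_)
  have := Ideal.prod_mem_prod (s := Finset.univ) (I := fun _ : Fin s =>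
    Ideal.span {X 0, X 1, (X 3 : MvPolynomial (Fin 4) k)})
    (x := fun i => X 0 - C (m i) * X 1) fun i _ =>
      sub_mem (Ideal.subset_span (by simp)) (Ideal.mul_mem_left _ _ (Ideal.subset_span (by simp)))
  simpa using this

/-- The ideal of the cone is contained in the saturation of the ideal of the special fiber. -/
theorem exists_X_pow_mul_mem_fiberIdeal (hs : 1 ≤ s) (hm : Function.Injective m) (hN : N ≠ 0)
    (hX : X 2 ^ (s - 2) * X 3 ^ 2 ∈ fiberIdeal m p N 0) (c : Fin 4) :
    ∃ M, ∀ g ∈ coneIdeal m, X c ^ M * g ∈ fiberIdeal m p N 0 := by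
  have hprod : ∏ i, (X 0 - C (m i) * X 1) ∈ fiberIdeal m p N 0 := by
    simpa using X_pow_mul_mem_fiberIdeal (m := m) (p := p) hN (r := 0)
      (Ideal.subset_span ⟨∅, by simp, rfl⟩)
  have hz (α β : ℕ) (h : α + β = s - 1) : X 3 * (X 0 ^ α * X 1 ^ β) ∈ fiberIdeal m p N 0 := by
    simpa using X_pow_mul_mem_fiberIdeal (p := p) hN
      (X_pow_mul_X_pow_mem_prodIdeal hm (s - 1) Finset.univ (by simp; omega) α β h)
  have key (M : ℕ) (hM : X c ^ M * X 3 ∈ fiberIdeal m p N 0) :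
      ∃ M, ∀ g ∈ coneIdeal m, X c ^ M * g ∈ fiberIdeal m p N 0 := by
    refine ⟨M, fun g hg => ?_⟩
    obtain ⟨q, r, rfl⟩ := exists_eq_prod_mul_add_of_mem_iInf hm hg.1
    rw [mul_add, ← mul_assoc _ (X 3)]
    exact add_mem (Ideal.mul_mem_left _ _ (Ideal.mul_mem_right _ _ hprod))
      (Ideal.mul_mem_right _ _ hM)
  fin_cases c
  · refine key (s - 1) ?_
    simpa [mul_comm] using hz (s - 1) 0 (by simp)
  · refine key (s - 1) ?_
    simpa [mul_comm] using hz 0 (s - 1) (by simp)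
  · refine ⟨s - 2, fun g hg => ?_⟩
    obtain ⟨q, r, rfl⟩ := exists_eq_prod_mul_add_of_mem_iInf hm hg.1
    have hfat : X 3 * r ∈ fatPointIdeal k s :=
      ((fatPointIdeal k s).add_mem_iff_right (prod_mul_mem_fatPointIdeal m q)).1 hg.2
    rw [mul_add]
    refine add_mem (Ideal.mul_mem_left _ _ (Ideal.mul_mem_right _ _ hprod)) ?_
    have hsupp : ∀ d ∈ (X 3 * r).support, X 2 ^ (s - 2) * monomial d (coeff d (X 3 * r)) ∈
        fiberIdeal m p N 0 := by
      intro d hd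
      have hd3 : 1 ≤ d 3 := by
        rw [mem_support_iff, coeff_X_mul'] at hd
        by_contra h
        simp [show d 3 = 0 by omega] at hd
      rw [monomial_eq, Finsupp.prod_fintype _ _ (by simp), Fin.prod_univ_four]
      by_cases h2 : 2 ≤ d 3
      · refine Ideal.mem_of_dvd _ ?_ hX
        obtain ⟨e, he⟩ := Nat.exists_eq_add_of_le h2
        rw [he, pow_add]
        exact ⟨C (coeff d (X 3 * r)) * (X 0 ^ d 0 * X 1 ^ d 1 * X 2 ^ d 2 * X 3 ^ e), by ring⟩
      · have h1 : s - 1 ≤ d 0 + d 1 := by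
          have := of_mem_fatPointIdeal hfat hd
          omega
        have hd3' : d 3 = 1 := by omega
        obtain ⟨e₀, he₀⟩ := Nat.exists_eq_add_of_le (min_le_left (d 0) (s - 1))
        obtain ⟨e₁, he₁⟩ := Nat.exists_eq_add_of_le
          (by omega : s - 1 - min (d 0) (s - 1) ≤ d 1)
        refine Ideal.mem_of_dvd _ ?_
          (hz (min (d 0) (s - 1)) (s - 1 - min (d 0) (s - 1)) (by omega))
        generalize hα : min (d 0) (s - 1) = α at *
        rw [hd3', he₀, he₁, pow_add, pow_add]
        exact ⟨X 2 ^ (s - 2) * C (coeff d (X 3 * r)) * (X 0 ^ e₀ * X 1 ^ e₁ * X 2 ^ d 2), by ring⟩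
    rw [as_sum (X 3 * r), Finset.mul_sum]
    exact sum_mem hsupp
  · refine key s ?_
    refine Ideal.mul_mem_right _ _ ?_
    simpa using X_pow_mul_mem_fiberIdeal (m := m) (p := p) hN (r := s) (q := 1)
      (Ideal.subset_span ⟨Finset.univ, by simp, by simp⟩)

end LowerBound

/-! ### Vanishing at intersection points of lines in a plane -/

section Vanishing

variable {k : Type u} [Field k] {s : ℕ} {m : Fin s → k}

theorem exponents_add_eq_of_isHomogeneous {A : Type*} [CommRing A] {G : MvPolynomial (Fin 4) A}
    {n : ℕ} (hG : G.IsHomogeneous n) {d : Fin 4 →₀ ℕ} (hd : d ∈ G.support) :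
    d 0 + d 1 + d 2 + d 3 = n := by
  have := hG (mem_support_iff.1 hd)
  rwa [Pi.one_def, ← Finsupp.degree_eq_weight_one, Finsupp.degree_eq_sum,
    Fin.sum_univ_four] at this

theorem eval_smul_of_isHomogeneous {G : MvPolynomial (Fin 4) k} {n : ℕ} (hG : G.IsHomogeneous n)
    (c : k) (x : Fin 4 → k) : eval (c • x) G = c ^ n * eval x G := by
  rw [eval_eq', eval_eq', Finset.mul_sum]
  refine Finset.sum_congr rfl fun d hd => ?_
  have := exponents_add_eq_of_isHomogeneous hG hd
  rw [← Fin.sum_univ_four] at this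
  simp only [Pi.smul_apply, smul_eq_mul, mul_pow, Finset.prod_mul_distrib,
    Finset.prod_pow_eq_pow_sum]
  rw [← this]
  ring

/-- A plane curve whose equation has degree less than `s - 1` with respect to two of the variables
and which passes through the intersection points of the `s` lines `X₀ = mᵢ X₁ + mᵢ² X₂` is zero: it
contains each of the lines, since it meets it in too many points, and therefore it contains too
many lines. -/
theorem eq_zero_of_eval_eq_zero (hm : Function.Injective m) {G : MvPolynomial (Fin 4) k} {n r : ℕ}
    (hG : G.IsHomogeneous n) (hr : r + 2 ≤ s)
    (hsupp : ∀ d ∈ G.support, d 3 = 0 ∧ d 0 + d 1 ≤ r)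
    (h : ∀ i j, i ≠ j → eval ![-(m i * m j), -(m i + m j), 1, 0] G = 0) : G = 0 := by
  let κ : MvPolynomial (Fin 4) k →ₐ[k] Polynomial (Polynomial k) :=
    aeval ![Polynomial.X, Polynomial.C Polynomial.X, 1, 0]
  have hκ : κ G = ∑ d ∈ G.support,
      Polynomial.monomial (d 0) (Polynomial.monomial (d 1) (coeff d G)) := by
    rw [aeval_eq_eval₂Hom, coe_eval₂Hom, eval₂_eq']
    refine Finset.sum_congr rfl fun d hd => ?_
    have : algebraMap k (Polynomial (Polynomial k)) (coeff d G) =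
      Polynomial.C (Polynomial.C (coeff d G)) := rfl
    rw [Fin.prod_univ_four, this, ← Polynomial.C_mul_X_pow_eq_monomial,
      ← Polynomial.C_mul_X_pow_eq_monomial, map_mul, map_pow]
    simp [(hsupp d hd).1]
    ring
  -- The restriction to a line vanishes.
  have hline (i : Fin s) : (κ G).eval (Polynomial.C (m i) * Polynomial.X + Polynomial.C (m i ^ 2))
      = 0 := by
    have hi : ∀ j : {j // j ≠ i}, ((κ G).eval (Polynomial.C (m i) * Polynomial.X +
        Polynomial.C (m i ^ 2))).eval (-(m i + m j)) = 0 := by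
      intro j
      rw [← h i j j.2.symm]
      let F : MvPolynomial (Fin 4) k →ₐ[k] k := (Polynomial.aeval (-(m i + m j))).comp
        (((Polynomial.aeval (Polynomial.C (m i) * Polynomial.X +
          Polynomial.C (m i ^ 2))).restrictScalars k).comp κ)
      have hF : F = aeval ![-(m i * m j), -(m i + m j), 1, 0] := by
        ext c
        fin_cases c
        · simp [F, κ]; ring
        · simp [F, κ]
        · simp [F, κ]
        · simp [F, κ]
      have := DFunLike.congr_fun hF G
      simpa [F] using this
    refine Polynomial.eq_zero_of_natDegree_lt_card_of_eval_eq_zero _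
      (f := fun j : {j // j ≠ i} => -(m i + m j)) (fun a b hab => ?_) hi ?_
    · exact Subtype.ext (hm (add_left_cancel (neg_injective hab)))
    · have hdeg : ((κ G).eval (Polynomial.C (m i) * Polynomial.X +
          Polynomial.C (m i ^ 2))).natDegree ≤ r := by
        rw [hκ, Polynomial.eval_finsetSum]
        refine Polynomial.natDegree_sum_le_of_forall_le _ _ fun d hd => ?_
        rw [Polynomial.eval_monomial]
        refine Polynomial.natDegree_mul_le.trans ?_
        have h1 := Polynomial.natDegree_monomial_le (m := d 1) (coeff d G)
        have h2 : ((Polynomial.C (m i) * Polynomial.X + Polynomial.C (m i ^ 2)) ^ d 0).natDegree ≤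
            d 0 := by
          refine Polynomial.natDegree_pow_le.trans ?_
          calc d 0 * _ ≤ d 0 * 1 := Nat.mul_le_mul_left _ Polynomial.natDegree_linear_le
            _ = d 0 := mul_one _
        have := (hsupp d hd).2
        omega
      have : Fintype.card {j // j ≠ i} = s - 1 := by simp [Fintype.card_subtype_compl]
      omega
  have hzero : κ G = 0 := by
    refine Polynomial.eq_zero_of_natDegree_lt_card_of_eval_eq_zero _
      (f := fun i => Polynomial.C (m i) * Polynomial.X + Polynomial.C (m i ^ 2))
      (fun a b hab => hm ?_) hline ?_
    · have := congrArg (fun q => Polynomial.coeff q 1) hab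
      simpa [Polynomial.coeff_C, -map_pow] using this
    · have : (κ G).natDegree ≤ r := by
        rw [hκ]
        refine Polynomial.natDegree_sum_le_of_forall_le _ _ fun d hd => ?_
        have := (hsupp d hd).2
        exact (Polynomial.natDegree_monomial_le _).trans (by omega)
      simp only [Fintype.card_fin]
      omega
  by_contra hne
  obtain ⟨d, hd⟩ := Finset.nonempty_iff_ne_empty.2 (fun h => hne (support_eq_empty.1 h))
  have hcoeff := congrArg (fun q => Polynomial.coeff (Polynomial.coeff q (d 0)) (d 1)) hzero
  simp only [hκ, Polynomial.finsetSum_coeff, Polynomial.coeff_zero] at hcoeff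
  rw [Finset.sum_eq_single_of_mem d hd] at hcoeff
  · simp [mem_support_iff.1 hd] at hcoeff
  · intro e he hed
    rw [Polynomial.coeff_monomial]
    split_ifs with h0
    · rw [Polynomial.coeff_monomial, if_neg]
      intro h1
      have hn1 := exponents_add_eq_of_isHomogeneous hG hd
      have hn2 := exponents_add_eq_of_isHomogeneous hG he
      have h3 := (hsupp d hd).1
      have h3' := (hsupp e he).1
      refine hed (Finsupp.ext fun c => ?_)
      fin_cases c <;> simp <;> omega
    · simp

/-- The linear coefficient of a polynomial is divisible by common divisors of two of its roots. -/
theorem dvd_coeff_one {R : Type*} [CommRing R] [IsDomain R] {g : Polynomial R} {t a b : R}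
    (hab : a ≠ b) (ha : g.eval a = 0) (hb : g.eval b = 0) (hta : t ∣ a) (htb : t ∣ b) :
    t ∣ g.coeff 1 := by
  obtain ⟨h, rfl⟩ := Polynomial.dvd_iff_isRoot.2 ha
  have hb' : h.eval b = 0 := by
    simpa [sub_eq_zero, hab.symm] using hb
  obtain ⟨h, rfl⟩ := Polynomial.dvd_iff_isRoot.2 hb'
  simp only [sub_mul, Polynomial.coeff_sub, Polynomial.coeff_X_mul, Polynomial.coeff_C_mul,
    Polynomial.coeff_X_mul_zero, zero_sub]
  refine dvd_sub ?_ (Dvd.dvd.mul_right hta _)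
  simpa [Polynomial.mul_coeff_zero] using Dvd.dvd.mul_right htb _

end Vanishing

/-! ### The special fiber contains the cone -/

section UpperBound

variable {k : Type u} [Field k]

/-- The substitution `X₀ ↦ λ X₀`, `X₁ ↦ λ X₁`, `X₂ ↦ X₂`, `X₃ ↦ Z`, with values in
`k[X₀, …, X₃][λ][Z]`. -/
noncomputable def rescale (k : Type u) [Field k] : MvPolynomial (Fin 4) (Polynomial k) →+*
    Polynomial (Polynomial (MvPolynomial (Fin 4) k)) :=
  eval₂Hom (Polynomial.C.comp (Polynomial.mapRingHom C))
    ![Polynomial.C (Polynomial.X * Polynomial.C (X 0)),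
      Polynomial.C (Polynomial.X * Polynomial.C (X 1)), Polynomial.C (Polynomial.C (X 2)),
      Polynomial.X]

/-- The coefficient of `λ ^ r Z` in the rescaled polynomial. -/
noncomputable def rescaledCoeff (r : ℕ) (f : MvPolynomial (Fin 4) (Polynomial k)) :
    MvPolynomial (Fin 4) k :=
  ((rescale k f).coeff 1).coeff r

theorem coeff_rescaledCoeff (r : ℕ) (f : MvPolynomial (Fin 4) (Polynomial k)) (d : Fin 4 →₀ ℕ) :
    coeff d (rescaledCoeff r f) = if d 3 = 0 ∧ d 0 + d 1 ≤ r then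
      (coeff (d + Finsupp.single 3 1) f).coeff (r - (d 0 + d 1)) else 0 := by
  induction f using MvPolynomial.induction_on' with
  | add f g hf hg =>
    have : rescaledCoeff r (f + g) = rescaledCoeff r f + rescaledCoeff r g := by
      simp [rescaledCoeff]
    rw [this, coeff_add, hf, hg]
    split_ifs <;> simp
  | monomial e c =>
    let e' : Fin 4 →₀ ℕ := Finsupp.single 0 (e 0) + Finsupp.single 1 (e 1) + Finsupp.single 2 (e 2)
    have h1 : rescale k (monomial e c) =
        Polynomial.monomial (e 3) (Polynomial.X ^ (e 0 + e 1) * (c.map C *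
          Polynomial.C (monomial e' 1))) := by
      rw [rescale, eval₂Hom_monomial, Finsupp.prod_fintype _ _ (by simp), Fin.prod_univ_four,
        ← Polynomial.C_mul_X_pow_eq_monomial]
      have : (monomial e' 1 : MvPolynomial (Fin 4) k) = X 0 ^ e 0 * X 1 ^ e 1 * X 2 ^ e 2 := by
        simp [e', X_pow_eq_monomial, monomial_mul]
      rw [this]
      simp
      ring
    have h2 : rescaledCoeff r (monomial e c) = if e 3 = 1 ∧ e 0 + e 1 ≤ r then
        monomial e' (c.coeff (r - (e 0 + e 1))) else 0 := by
      rw [rescaledCoeff, h1, Polynomial.coeff_monomial]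
      by_cases h3 : e 3 = 1
      · rw [if_pos h3, Polynomial.coeff_X_pow_mul']
        simp only [h3, true_and]
        refine if_congr Iff.rfl ?_ rfl
        rw [Polynomial.coeff_mul_C, Polynomial.coeff_map, C_mul_monomial, mul_one]
      · simp [h3]
    rw [h2, coeff_monomial]
    by_cases he : e = d + Finsupp.single 3 1
    · have h0 : e 0 = d 0 := by simp [he]
      have h1 : e 1 = d 1 := by simp [he]
      have h3 : e 3 = d 3 + 1 := by simp [he]
      have he2 : e 2 = d 2 := by simp [he]
      rw [if_pos he, h0, h1, h3]
      simp only [Nat.add_eq_right]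
      split_ifs with h
      · rw [coeff_monomial, if_pos]
        refine Finsupp.ext fun c => ?_
        fin_cases c <;> simp [e', h0, h1, he2, h.1]
      · simp
    · rw [if_neg he]
      simp only [Polynomial.coeff_zero, ite_self]
      split_ifs with h
      · rw [coeff_monomial, if_neg]
        intro hd
        refine he (Finsupp.ext fun c => ?_)
        rw [← hd]
        fin_cases c <;> simp [e', h.1]
      · simp

variable {s : ℕ} {m : Fin s → k} {p : Fin s → LineParam k} {N : ℕ}

/-- Near the intersection point of their projections to the plane `X₃ = 0`, two moving lines are
close to the plane. Therefore the equations of their union, expanded with respect to `X₃`, have a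
linear term whose value at that point is close to zero. -/
theorem X_pow_dvd_eval₂_rescale (hp : ∀ i j, i ≠ j → (p i).det (p j) ≠ 0)
    {f : MvPolynomial (Fin 4) (Polynomial k)} (hf : f ∈ totalIdeal m p N) {i j : Fin s}
    (hij : i ≠ j) :
    ∃ x : Fin 4 → Polynomial k, (fun c => (x c).eval 0) =
      (m i - m j) • ![-(m i * m j), -(m i + m j), 1, 0] ∧
      Polynomial.X ^ N ∣ ((rescale k f).coeff 1).eval₂ (aeval x : _ →ₐ[k] Polynomial k).toRingHom
        Polynomial.X := by
  -- The projections meet at the point `(λ x 0 : λ x 1 : x 2)`.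
  let u (i : Fin s) := (movingLine (m i) (p i) N).u
  let w (i : Fin s) : Polynomial k :=
    Polynomial.C (m i ^ 2) + Polynomial.X * Polynomial.C ((p i).v - m i ^ 2)
  let x : Fin 4 → Polynomial k := ![u i * w j - u j * w i, w j - w i, u i - u j, 0]
  let z (l : Fin s) : Polynomial k := Polynomial.X ^ N *
    (Polynomial.C (p l).a * (Polynomial.X * (w j - w i)) + Polynomial.C (p l).b * (u i - u j))
  refine ⟨x, ?_, ?_⟩
  · ext c
    fin_cases c
    · simp [x, u, w, movingLine]; ring
    · simp [x, u, w, movingLine]; ring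
    · simp [x, u, w, movingLine]
    · simp [x]
  let σ : Polynomial (MvPolynomial (Fin 4) k) →+* Polynomial k :=
    Polynomial.eval₂RingHom (aeval x : _ →ₐ[k] Polynomial k).toRingHom Polynomial.X
  have hroot (l : Fin s) (hl : l = i ∨ l = j) : ((rescale k f).map σ).eval (z l) = 0 := by
    let F : MvPolynomial (Fin 4) (Polynomial k) →+* Polynomial k :=
      (Polynomial.evalRingHom (z l)).comp ((Polynomial.mapRingHom σ).comp (rescale k))
    have hF : F = eval₂Hom (RingHom.id _)
        ![Polynomial.X * x 0, Polynomial.X * x 1, x 2, z l] := by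
      refine MvPolynomial.ringHom_ext (fun c => ?_) fun c => ?_
      · have : (σ.comp (Polynomial.mapRingHom C)) = RingHom.id _ := by
          refine Polynomial.ringHom_ext (fun a => ?_) ?_
          · simp [σ, Polynomial.algebraMap_eq]
          · simp [σ]
        have := DFunLike.congr_fun this c
        simpa [F, rescale] using this
      · fin_cases c <;> simp [F, rescale, σ, mul_comm Polynomial.X]
    have hcomp : F = F.comp (movingLine (m l) (p l) N).subst.toRingHom := by
      rw [hF]
      refine MvPolynomial.ringHom_ext (fun c => by simp) fun c => ?_
      fin_cases c
      · rcases hl with rfl | rfl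
        · simp [x, u, w, movingLine]; ring
        · simp [x, u, w, movingLine]; ring
      · simp
      · simp
      · simp [x, z, movingLine]; ring
    have h0 := (LineParam.mem_ideal _).1 (Ideal.mem_iInf.1 hf l)
    change F f = 0
    rw [hcomp]
    simp [h0]
  have hne : z i ≠ z j := by
    intro h
    have := congrArg (Polynomial.eval 1) h
    simp [z, u, w, movingLine] at this
    refine hp i j hij ?_
    rw [LineParam.det]
    linear_combination this
  have := dvd_coeff_one hne (hroot i (Or.inl rfl)) (hroot j (Or.inr rfl))
    (t := Polynomial.X ^ N) (dvd_mul_right _ _) (dvd_mul_right _ _)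
  rwa [Polynomial.coeff_map] at this

/-- The rescaled coefficients of an equation of the family define curves in the plane `X₃ = 0`
through the limits of the rescaled intersection points of the projected lines, and vanish if their
degree in `X₀, X₁` is small: the first nonzero one has these points as zeros, because the later ones
have an additional factor `λ`. -/
theorem rescaledCoeff_eq_zero (hp : ∀ i j, i ≠ j → (p i).det (p j) ≠ 0)
    (hm : Function.Injective m) (hN : s ≤ N + 1) {f : MvPolynomial (Fin 4) (Polynomial k)}
    (hf : f ∈ totalIdeal m p N) {n : ℕ} (hfn : f.IsHomogeneous n) (r : ℕ) (hr : r + 2 ≤ s) :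
    rescaledCoeff r f = 0 := by
  induction r using Nat.strong_induction_on with
  | _ r ih =>
  have hsupp (d : Fin 4 →₀ ℕ) (hd : d ∈ (rescaledCoeff r f).support) :
      d 3 = 0 ∧ d 0 + d 1 ≤ r ∧ d + Finsupp.single 3 1 ∈ f.support := by
    rw [mem_support_iff, coeff_rescaledCoeff] at hd
    split_ifs at hd with h
    · exact ⟨h.1, h.2, mem_support_iff.2 fun h => hd (by rw [h, Polynomial.coeff_zero])⟩
    · exact absurd rfl hd
  have hhom : (rescaledCoeff r f).IsHomogeneous (n - 1) := by
    intro d hd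
    have := exponents_add_eq_of_isHomogeneous hfn (hsupp d (mem_support_iff.2 hd)).2.2
    simp at this
    rw [Pi.one_def, ← Finsupp.degree_eq_weight_one, Finsupp.degree_eq_sum, Fin.sum_univ_four]
    omega
  refine eq_zero_of_eval_eq_zero hm hhom hr
    (fun d hd => ⟨(hsupp d hd).1, (hsupp d hd).2.1⟩) fun i j hij => ?_
  obtain ⟨x, hx, hdvd⟩ := X_pow_dvd_eval₂_rescale hp hf hij
  obtain ⟨B, hB⟩ : Polynomial.X ^ r ∣ (rescale k f).coeff 1 :=
    Polynomial.X_pow_dvd_iff.2 fun d hd => ih d hd (by omega)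
  have hBr : B.coeff 0 = rescaledCoeff r f := by
    rw [rescaledCoeff, hB, Polynomial.coeff_X_pow_mul', if_pos le_rfl, Nat.sub_self]
  rw [hB, Polynomial.eval₂_mul, Polynomial.eval₂_X_pow,
    ← Nat.sub_add_cancel (by omega : r ≤ N), add_comm, pow_add,
    mul_dvd_mul_iff_left (pow_ne_zero _ Polynomial.X_ne_zero)] at hdvd
  have h0 : (B.eval₂ (aeval x : _ →ₐ[k] Polynomial k).toRingHom Polynomial.X).eval 0 = 0 := by
    rw [← Polynomial.coeff_zero_eq_eval_zero, ← Polynomial.X_dvd_iff]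
    exact (dvd_pow_self _ (by omega)).trans hdvd
  have h1 : (Polynomial.evalRingHom (0 : k)).comp (Polynomial.eval₂RingHom
      (aeval x : _ →ₐ[k] Polynomial k).toRingHom Polynomial.X) =
      (eval fun c => (x c).eval 0).comp Polynomial.constantCoeff := by
    refine Polynomial.ringHom_ext (fun g => ?_) (by simp)
    have : (Polynomial.evalRingHom (0 : k)).comp (aeval x : _ →ₐ[k] Polynomial k).toRingHom =
        eval fun c => (x c).eval 0 := by
      refine MvPolynomial.ringHom_ext (fun c => ?_) fun c => ?_
      · simp [Polynomial.algebraMap_eq]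
      · simp
    simpa using DFunLike.congr_fun this g
  have h2 := DFunLike.congr_fun h1 B
  simp only [RingHom.comp_apply, Polynomial.coe_evalRingHom, Polynomial.coe_eval₂RingHom, h0,
    Polynomial.constantCoeff_apply, hBr, hx] at h2
  rw [eval_smul_of_isHomogeneous hhom] at h2
  exact (mul_eq_zero.1 h2.symm).resolve_left (pow_ne_zero _ (sub_ne_zero.2 (hm.ne hij)))

/-- The ideal of the special fiber is contained in the ideal of the cone. -/
theorem fiberIdeal_zero_le_coneIdeal (hp : ∀ i j, i ≠ j → (p i).det (p j) ≠ 0)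
    (hm : Function.Injective m) (hN0 : N ≠ 0) (hN : s ≤ N + 1) :
    fiberIdeal m p N 0 ≤ coneIdeal m := by
  have hle : fiberIdeal m p N 0 ≤ ⨅ i, (⟨m i, 0, 0, 0⟩ : LineParam k).ideal := by
    simpa only [movingLine_eval_zero _ _ hN0] using fiberIdeal_le m p N 0
  refine le_inf hle ?_
  rw [fiberIdeal, Ideal.map_le_iff_le_comap]
  intro f hf
  rw [Ideal.mem_comap]
  set g := MvPolynomial.map (Polynomial.evalRingHom (0 : k)) f
  have hg : g ∈ fiberIdeal m p N 0 := Ideal.mem_map_of_mem _ hf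
  obtain ⟨q, t, hqt⟩ := exists_eq_prod_mul_add_of_mem_iInf hm (hle hg)
  have hq : (∏ i, (X 0 - C (m i) * X 1)) * q ∈ fatPointIdeal k s := prod_mul_mem_fatPointIdeal m q
  rw [g.as_sum]
  refine sum_mem fun d hd => monomial_mem_fatPointIdeal ?_ _
  by_contra! hcon
  have hcon' : ¬ (2 ≤ d 3 ∨ s ≤ d 0 + d 1 + d 3) := by omega
  refine mem_support_iff.1 hd ?_
  rcases Nat.eq_zero_or_pos (d 3) with h3 | h3
  · rw [hqt, coeff_add, notMem_support_iff.1 fun h => hcon' (of_mem_fatPointIdeal hq h),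
      coeff_X_mul', if_neg (by simp [h3]), add_zero]
  · -- Only the homogeneous component of the degree of the monomial matters.
    have h31 : d 3 = 1 := by omega
    set n := d.degree
    have hfn : homogeneousComponent n f ∈ totalIdeal m p N := by
      have := isHomogeneous_totalIdeal m p N n hf
      rwa [decompose_apply_grading] at this
    have := rescaledCoeff_eq_zero hp hm hN hfn (homogeneousComponent_isHomogeneous n f)
      (d 0 + d 1) (by omega)
    have hd' : d - Finsupp.single 3 1 + Finsupp.single 3 1 = d := by
      refine Finsupp.ext fun c => ?_
      fin_cases c <;> simp [h31]
    have h := coeff_rescaledCoeff (d 0 + d 1) (homogeneousComponent n f) (d - Finsupp.single 3 1)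
    rw [this, coeff_zero, hd', if_pos (by simp [h31]), coeff_homogeneousComponent, if_pos rfl] at h
    rw [coeff_map, Polynomial.coe_evalRingHom, ← Polynomial.coeff_zero_eq_eval_zero]
    simpa using h.symm

end UpperBound

/-! ### Linear forms and linear subspaces -/

section ZeroLocus

variable {A : Type u} [CommRing A]

/-- The closed subset of `ℙ³` defined by an ideal of the homogeneous coordinate ring. -/
def zeroLocus (I : Ideal (MvPolynomial (Fin 4) A)) : Closeds (P3 A) :=
  ⟨ProjectiveSpectrum.zeroLocus (grading A) I, ProjectiveSpectrum.isClosed_zeroLocus _ _⟩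

theorem mem_zeroLocus {I : Ideal (MvPolynomial (Fin 4) A)} {x : P3 A} :
    x ∈ zeroLocus I ↔ I ≤ x.asHomogeneousIdeal.toIdeal := Iff.rfl

theorem exists_X_notMem (x : P3 A) : ∃ j, X j ∉ x.asHomogeneousIdeal := by
  have h := iSup_chart_eq_top (A := A) (b := X) (fun i => mem_grading.2 (isHomogeneous_X A i))
    fun j => Ideal.subset_span ⟨j, rfl⟩
  obtain ⟨j, hj⟩ := Opens.mem_iSup.1 (h ▸ Opens.mem_top x)
  exact ⟨j, hj⟩

end ZeroLocus

section LinForm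

variable (k : Type u) [Field k] (A B : Type u) [CommRing A] [Algebra k A] [CommRing B] [Algebra k B]

/-- The linear form with the given vector of coefficients. -/
noncomputable def linForm : (Fin 4 → k) →ₗ[k] MvPolynomial (Fin 4) A :=
  Fintype.linearCombination k X

variable {k}

theorem linForm_single (j : Fin 4) : linForm k A (Pi.single j (1 : k)) = X j := by
  simp [linForm]

theorem linForm_mem_grading (v : Fin 4 → k) : linForm k A v ∈ grading A 1 := by
  rw [linForm, Fintype.linearCombination_apply]
  refine sum_mem fun j _ => ?_
  rw [← algebraMap_smul A]
  exact Submodule.smul_mem _ _ (mem_grading.2 (isHomogeneous_X A j))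

theorem map_linForm {φ : A →+* B} (hφ : φ.comp (algebraMap k A) = algebraMap k B)
    (v : Fin 4 → k) : MvPolynomial.map φ (linForm k A v) = linForm k B v := by
  rw [linForm, linForm, Fintype.linearCombination_apply, Fintype.linearCombination_apply, map_sum]
  refine Finset.sum_congr rfl fun j _ => ?_
  rw [← algebraMap_smul A (v j) (X j), ← algebraMap_smul B (v j) (X j), smul_eq_C_mul,
    smul_eq_C_mul, map_mul, map_C, map_X, ← hφ]
  rfl

theorem linForm_injective : Function.Injective (linForm k k) := by
  have := linearIndependent_X (σ := Fin 4) (R := k)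
  exact linearIndependent_iff_injective_fintypeLinearCombination.1 this

theorem exists_linForm_eq {f : MvPolynomial (Fin 4) k} (hf : f.IsHomogeneous 1) :
    ∃ v, linForm k k v = f := by
  have : f ∈ homogeneousSubmodule (Fin 4) k 1 := hf
  rw [homogeneousSubmodule_one_eq_span_X, ← Fintype.range_linearCombination] at this
  exact this

/-- The linear substitution induced by an endomorphism of the space of linear forms. -/
noncomputable def linSubst (e : (Fin 4 → k) →ₗ[k] (Fin 4 → k)) :
    MvPolynomial (Fin 4) A →ₐ[A] MvPolynomial (Fin 4) A :=
  aeval fun j => linForm k A (e (Pi.single j 1))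

variable {A} in
theorem linSubst_linForm (e : (Fin 4 → k) →ₗ[k] (Fin 4 → k)) (v : Fin 4 → k) :
    linSubst A e (linForm k A v) = linForm k A (e v) := by
  have : ((linSubst A e).toLinearMap.restrictScalars k).comp (linForm k A) =
      (linForm k A).comp e := by
    refine (Pi.basisFun k (Fin 4)).ext fun j => ?_
    simp [linForm_single, linSubst]
  exact DFunLike.congr_fun this v

theorem linSubst_comp (e e' : (Fin 4 → k) →ₗ[k] (Fin 4 → k)) :
    (linSubst A e).comp (linSubst A e') = linSubst A (e.comp e') := by
  ext1 j
  rw [AlgHom.comp_apply]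
  simp only [linSubst, aeval_X]
  exact linSubst_linForm _ _

theorem linSubst_id : linSubst A (LinearMap.id : (Fin 4 → k) →ₗ[k] _) = AlgHom.id A _ := by
  ext1 j
  simp [linSubst, linForm_single]

theorem isHomogeneous_linSubst (e : (Fin 4 → k) →ₗ[k] (Fin 4 → k)) {n : ℕ}
    {f : MvPolynomial (Fin 4) A} (hf : f.IsHomogeneous n) : (linSubst A e f).IsHomogeneous n := by
  rw [linSubst]
  simpa only [one_mul] using hf.aeval (n := 1) _ fun j => mem_grading.1 (linForm_mem_grading A _)

theorem map_linSubst {φ : A →+* B} (hφ : φ.comp (algebraMap k A) = algebraMap k B)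
    (e : (Fin 4 → k) →ₗ[k] (Fin 4 → k)) (f : MvPolynomial (Fin 4) A) :
    MvPolynomial.map φ (linSubst A e f) = linSubst B e (MvPolynomial.map φ f) := by
  have : (MvPolynomial.map φ).comp (linSubst A e).toRingHom =
      (linSubst B e).toRingHom.comp (MvPolynomial.map φ) := by
    refine MvPolynomial.ringHom_ext (fun c => ?_) fun j => ?_
    · simp
    · simp [linSubst, map_linForm A B hφ]
  exact DFunLike.congr_fun this f

/-- The linear change of coordinates induced by an automorphism of the space of linear forms. -/
noncomputable def linEquiv (e : (Fin 4 → k) ≃ₗ[k] (Fin 4 → k)) :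
    MvPolynomial (Fin 4) A ≃ₐ[A] MvPolynomial (Fin 4) A :=
  AlgEquiv.ofAlgHom (linSubst A e.toLinearMap) (linSubst A e.symm.toLinearMap)
    (by rw [linSubst_comp, LinearEquiv.comp_symm, linSubst_id])
    (by rw [linSubst_comp, LinearEquiv.symm_comp, linSubst_id])

end LinForm

section LinIdeal

variable {k : Type u} [Field k]

/-- The ideal generated by a space of linear forms. -/
noncomputable def linIdeal (W : Submodule k (Fin 4 → k)) : Ideal (MvPolynomial (Fin 4) k) :=
  Ideal.span (linForm k k '' W)

theorem linIdeal_span (S : Set (Fin 4 → k)) :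
    linIdeal (Submodule.span k S) = Ideal.span (linForm k k '' S) := by
  refine le_antisymm (Ideal.span_le.2 ?_)
    (Ideal.span_mono (Set.image_mono Submodule.subset_span))
  rintro _ ⟨v, hv, rfl⟩
  let I : Submodule k (MvPolynomial (Fin 4) k) :=
    (Ideal.span (linForm k k '' S)).restrictScalars k
  have : Submodule.span k S ≤ I.comap (linForm k k) :=
    Submodule.span_le.2 fun v hv => Ideal.subset_span ⟨v, hv, rfl⟩
  exact this hv

theorem linIdeal_sup (W W' : Submodule k (Fin 4 → k)) :
    linIdeal (W ⊔ W') = linIdeal W ⊔ linIdeal W' := by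
  conv_lhs => rw [← W.span_eq, ← W'.span_eq, ← Submodule.span_union, linIdeal_span,
    Set.image_union, Ideal.span_union]
  rfl

theorem linIdeal_mono {W W' : Submodule k (Fin 4 → k)} (h : W ≤ W') : linIdeal W ≤ linIdeal W' :=
  Ideal.span_mono (Set.image_mono h)

theorem isHomogeneous_linIdeal (W : Submodule k (Fin 4 → k)) :
    (linIdeal W).IsHomogeneous (grading k) := by
  refine Ideal.homogeneous_span _ _ ?_
  rintro _ ⟨v, -, rfl⟩
  exact ⟨1, linForm_mem_grading k v⟩

/-- The ideal generated by a space of linear forms is the kernel of a linear substitution. -/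
theorem exists_linIdeal_eq_ker (W : Submodule k (Fin 4 → k)) :
    ∃ π : (Fin 4 → k) →ₗ[k] (Fin 4 → k), LinearMap.ker π = W ∧
      linIdeal W = RingHom.ker (linSubst k π) := by
  obtain ⟨g, hg⟩ := W.mkQ.exists_rightInverse_of_surjective W.range_mkQ
  have hgv (v) : W.mkQ (g v) = v := DFunLike.congr_fun hg v
  have hker : LinearMap.ker (g.comp W.mkQ) = W := by
    rw [LinearMap.ker_comp_of_ker_eq_bot _
      (LinearMap.ker_eq_bot.2 (Function.LeftInverse.injective hgv)), Submodule.ker_mkQ]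
  refine ⟨g.comp W.mkQ, hker, le_antisymm (Ideal.span_le.2 ?_) fun f hf => ?_⟩
  · rintro _ ⟨v, hv, rfl⟩
    have : (g.comp W.mkQ) v = 0 := by rwa [← LinearMap.mem_ker, hker]
    rw [SetLike.mem_coe, RingHom.mem_ker, linSubst_linForm, this, map_zero]
  · have h : (Ideal.Quotient.mkₐ k (linIdeal W)).comp (linSubst k (g.comp W.mkQ)) =
        Ideal.Quotient.mkₐ k (linIdeal W) := by
      ext1 j
      simp only [AlgHom.comp_apply, linSubst, aeval_X]
      conv_rhs => rw [← linForm_single (k := k)]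
      refine (Ideal.Quotient.mk_eq_mk_iff_sub_mem _ _).2 ?_
      rw [← map_sub]
      refine Ideal.subset_span ⟨_, ?_, rfl⟩
      refine (Submodule.Quotient.mk_eq_zero W).1 ?_
      rw [← Submodule.mkQ_apply, map_sub, LinearMap.comp_apply, hgv, sub_self]
    have h' := DFunLike.congr_fun h f
    rw [AlgHom.comp_apply, RingHom.mem_ker.1 hf, map_zero] at h'
    exact Ideal.Quotient.eq_zero_iff_mem.1 h'.symm

theorem isPrime_linIdeal (W : Submodule k (Fin 4 → k)) : (linIdeal W).IsPrime := by
  obtain ⟨π, -, h⟩ := exists_linIdeal_eq_ker W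
  rw [h]
  exact RingHom.ker_isPrime _

theorem linForm_mem_linIdeal {W : Submodule k (Fin 4 → k)} {v : Fin 4 → k} :
    linForm k k v ∈ linIdeal W ↔ v ∈ W := by
  refine ⟨fun hv => ?_, fun hv => Ideal.subset_span ⟨v, hv, rfl⟩⟩
  obtain ⟨π, hπ, h⟩ := exists_linIdeal_eq_ker W
  rw [h, RingHom.mem_ker, linSubst_linForm, map_eq_zero_iff _ linForm_injective] at hv
  rwa [← hπ, LinearMap.mem_ker]

/-- The generic point of a nonempty linear subspace. -/
theorem exists_asHomogeneousIdeal_eq_linIdeal {W : Submodule k (Fin 4 → k)} (hW : W ≠ ⊤) :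
    ∃ x : P3 k, x.asHomogeneousIdeal.toIdeal = linIdeal W := by
  refine ⟨⟨⟨linIdeal W, isHomogeneous_linIdeal W⟩, isPrime_linIdeal W, fun h => hW ?_⟩, rfl⟩
  have hX (j) : Pi.single j (1 : k) ∈ W := by
    rw [← linForm_mem_linIdeal, linForm_single]
    exact h (HomogeneousIdeal.mem_irrelevant_of_mem _ Nat.one_pos
      (mem_grading.2 (isHomogeneous_X k j)))
  rw [eq_top_iff, ← (Pi.basisFun k (Fin 4)).span_eq, Submodule.span_le]
  rintro _ ⟨j, rfl⟩
  simpa using hX j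

theorem zeroLocus_linIdeal_le_iff {W W' : Submodule k (Fin 4 → k)} (hW : W ≠ ⊤) :
    zeroLocus (linIdeal W) ≤ zeroLocus (linIdeal W') ↔ W' ≤ W := by
  refine ⟨fun h v hv => ?_, fun h x hx => mem_zeroLocus.2 ((linIdeal_mono h).trans hx)⟩
  obtain ⟨x, hx⟩ := exists_asHomogeneousIdeal_eq_linIdeal hW
  have h1 : linIdeal W' ≤ x.asHomogeneousIdeal.toIdeal := h (mem_zeroLocus.2 hx.ge)
  rw [hx] at h1
  exact linForm_mem_linIdeal.1 (h1 (linForm_mem_linIdeal.2 hv))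

theorem disjoint_zeroLocus_linIdeal_iff {W W' : Submodule k (Fin 4 → k)} :
    Disjoint (zeroLocus (linIdeal W)) (zeroLocus (linIdeal W')) ↔ W ⊔ W' = ⊤ := by
  constructor
  · intro h
    by_contra hne
    obtain ⟨x, hx⟩ := exists_asHomogeneousIdeal_eq_linIdeal hne
    rw [linIdeal_sup] at hx
    exact (h.le_bot (x := x)
      ⟨mem_zeroLocus.2 (le_sup_left.trans hx.ge), mem_zeroLocus.2 (le_sup_right.trans hx.ge)⟩).elim
  · intro h
    rw [disjoint_iff_inf_le]
    rintro x ⟨hx, hx'⟩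
    obtain ⟨j, hj⟩ := exists_X_notMem x
    refine (hj ?_).elim
    have : linIdeal (W ⊔ W') ≤ x.asHomogeneousIdeal.toIdeal := by
      rw [linIdeal_sup]
      exact sup_le hx hx'
    refine this ?_
    rw [← linForm_single (k := k), linForm_mem_linIdeal, h]
    trivial

theorem isLinearSubspace_iff {c : ℕ} {Z : Closeds (P3 k)} :
    IsLinearSubspace c Z ↔
      ∃ W : Submodule k (Fin 4 → k), Module.finrank k W = c ∧ Z = zeroLocus (linIdeal W) := by
  constructor
  · rintro ⟨f, hf, hli, hZ⟩
    choose v hv using fun i => exists_linForm_eq (hf i)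
    obtain rfl : linForm k k ∘ v = f := funext hv
    refine ⟨Submodule.span k (Set.range v), ?_, ?_⟩
    · rw [finrank_span_eq_card (hli.of_comp _), Fintype.card_fin]
    · ext x
      rw [linIdeal_span, ← Set.range_comp]
      change x ∈ Z ↔ Ideal.span _ ≤ _
      rw [hZ, Ideal.span_le, Set.range_subset_iff]
      rfl
  · rintro ⟨W, hW, rfl⟩
    let b := Module.finBasisOfFinrankEq k W hW
    refine ⟨fun i => linForm k k (b i), fun i => mem_grading.1 (linForm_mem_grading k _), ?_,
      fun x => ?_⟩
    · exact (b.linearIndependent.map' W.subtype W.ker_subtype).map' (linForm k k)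
        (LinearMap.ker_eq_bot.2 linForm_injective)
    · have h : W = Submodule.span k (Set.range fun i => (b i : Fin 4 → k)) := by
        have := congrArg (Submodule.map W.subtype) b.span_eq
        rw [Submodule.map_span, ← Set.range_comp, Submodule.map_top,
          Submodule.range_subtype] at this
        exact this.symm
      rw [mem_zeroLocus]
      conv_lhs => rw [h, linIdeal_span, ← Set.range_comp, Ideal.span_le, Set.range_subset_iff]
      rfl

theorem idealSheaf_zeroLocus_linIdeal_ideal (W : Submodule k (Fin 4 → k))
    {f : MvPolynomial (Fin 4) k} (hf : f ∈ grading k 1) :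
    (idealSheaf (zeroLocus (linIdeal W))).ideal (chart f hf) =
      (linIdeal W).map (chartHom f hf) :=
  vanishingIdeal_ideal_chart hf (isHomogeneous_linIdeal W) (isPrime_linIdeal W)
    fun _ => mem_zeroLocus

end LinIdeal

/-! ### Normal form of disjoint lines -/

section NormalForm

variable {k : Type u} [Field k]

/-- The space of linear forms vanishing on the line with the given parameters with respect to the
coordinates `b`. -/
def LineParam.subspace (b : Module.Basis (Fin 4) k (Fin 4 → k)) (p : LineParam k) :
    Submodule k (Fin 4 → k) :=
  Submodule.span k {b 0 - p.u • b 1 - p.v • b 2, b 3 - p.a • b 1 - p.b • b 2}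

theorem finrank_span_pair_eq_two {V : Type*} [AddCommGroup V] [Module k V] {x y : V}
    (h : ∀ s t : k, s • x + t • y = 0 → s = 0 ∧ t = 0) :
    Module.finrank k (Submodule.span k {x, y}) = 2 := by
  have := finrank_span_eq_card (LinearIndependent.pair_iff.2 h)
  rwa [Matrix.range_cons_cons_empty, Fintype.card_fin] at this

theorem LineParam.finrank_subspace (b : Module.Basis (Fin 4) k (Fin 4 → k)) (p : LineParam k) :
    Module.finrank k (p.subspace b) = 2 := by
  refine finrank_span_pair_eq_two fun s t h => ?_
  have := Fintype.linearIndependent_iff.1 b.linearIndependent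
    ![s, -(s * p.u + t * p.a), -(s * p.v + t * p.b), t] (by
      rw [← h, Fin.sum_univ_four]
      simp
      module)
  exact ⟨this 0, this 3⟩

/-- The parameters of disjoint lines have nonzero determinant. -/
theorem LineParam.det_ne_zero_of_sup_eq_top (b : Module.Basis (Fin 4) k (Fin 4 → k))
    {p q : LineParam k} (h : p.subspace b ⊔ q.subspace b = ⊤) : p.det q ≠ 0 := by
  have hex (v : Fin 4 → k) : ∃ α β γ δ : k,
      α • (b 0 - p.u • b 1 - p.v • b 2) + β • (b 3 - p.a • b 1 - p.b • b 2) +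
      (γ • (b 0 - q.u • b 1 - q.v • b 2) + δ • (b 3 - q.a • b 1 - q.b • b 2)) = v := by
    obtain ⟨x, hx, y, hy, rfl⟩ := Submodule.mem_sup.1 (h ▸ Submodule.mem_top : v ∈ _)
    obtain ⟨α, β, rfl⟩ := Submodule.mem_span_pair.1 hx
    obtain ⟨γ, δ, rfl⟩ := Submodule.mem_span_pair.1 hy
    exact ⟨α, β, γ, δ, rfl⟩
  have hli := Fintype.linearIndependent_iff.1 b.linearIndependent
  obtain ⟨α, β, γ, δ, h1⟩ := hex (b 1)
  obtain ⟨α', β', γ', δ', h2⟩ := hex (b 2)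
  have e1 := hli ![α + γ, -(α * p.u + β * p.a + γ * q.u + δ * q.a) - 1,
    -(α * p.v + β * p.b + γ * q.v + δ * q.b), β + δ] (by
      rw [← sub_eq_zero] at h1
      rw [← h1, Fin.sum_univ_four]
      simp
      module)
  have e2 := hli ![α' + γ', -(α' * p.u + β' * p.a + γ' * q.u + δ' * q.a),
    -(α' * p.v + β' * p.b + γ' * q.v + δ' * q.b) - 1, β' + δ'] (by
      rw [← sub_eq_zero] at h2
      rw [← h2, Fin.sum_univ_four]
      simp
      module)
  have e10 : α + γ = 0 := e1 0
  have e11 : -(α * p.u + β * p.a + γ * q.u + δ * q.a) - 1 = 0 := e1 1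
  have e12 : -(α * p.v + β * p.b + γ * q.v + δ * q.b) = 0 := e1 2
  have e13 : β + δ = 0 := e1 3
  have e20 : α' + γ' = 0 := e2 0
  have e21 : -(α' * p.u + β' * p.a + γ' * q.u + δ' * q.a) = 0 := e2 1
  have e22 : -(α' * p.v + β' * p.b + γ' * q.v + δ' * q.b) - 1 = 0 := e2 2
  have e23 : β' + δ' = 0 := e2 3
  obtain rfl : γ = -α := by linear_combination e10
  obtain rfl : δ = -β := by linear_combination e13
  obtain rfl : γ' = -α' := by linear_combination e20
  obtain rfl : δ' = -β' := by linear_combination e23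
  have f1 : α * (p.u - q.u) + β * (p.a - q.a) = -1 := by linear_combination -e11
  have f2 : α * (p.v - q.v) + β * (p.b - q.b) = 0 := by linear_combination -e12
  have f3 : α' * (p.u - q.u) + β' * (p.a - q.a) = 0 := by linear_combination -e21
  have f4 : α' * (p.v - q.v) + β' * (p.b - q.b) = -1 := by linear_combination -e22
  intro hdet
  rw [LineParam.det] at hdet
  -- The matrix of coefficients is inverse, up to sign, to the matrix of the determinant.
  have : (1 : k) = 0 := by
    have h12 : (α * (p.u - q.u) + β * (p.a - q.a)) * (α' * (p.v - q.v) + β' * (p.b - q.b)) -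
        (α * (p.v - q.v) + β * (p.b - q.b)) * (α' * (p.u - q.u) + β' * (p.a - q.a)) = 1 := by
      rw [f1, f2, f3, f4]; ring
    linear_combination (α * β' - β * α') * hdet - h12
  exact one_ne_zero this

/-- Finitely many pairwise disjoint lines in `ℙ³`, one of which lies in a given plane, in suitable
coordinates: the span of the coordinates `b 1` and `b 2` is a common complement of the spaces of
linear forms vanishing on the lines. -/
theorem exists_basis_lineParam [Infinite k] {s : ℕ} {W : Fin s → Submodule k (Fin 4 → k)}
    (hW : ∀ i, Module.finrank k (W i) = 2) (hsup : ∀ i j, i ≠ j → W i ⊔ W j = ⊤)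
    {i₀ : Fin s} {z : Fin 4 → k} (hz : z ≠ 0) (hzW : z ∈ W i₀) :
    ∃ (b : Module.Basis (Fin 4) k (Fin 4 → k)) (p : Fin s → LineParam k), b 3 = z ∧
      p i₀ = ⟨0, 0, 0, 0⟩ ∧ (∀ i, W i = (p i).subspace b) ∧
      ∀ i j, i ≠ j → (p i).det (p j) ≠ 0 := by
  have hV : Module.finrank k (Fin 4 → k) = 4 := by simp
  have havoid (W' : Fin s → Submodule k (Fin 4 → k)) (h : ∀ i, Module.finrank k (W' i) < 4) :
      ∃ v, ∀ i, v ∉ W' i := by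
    by_contra! hcon
    obtain ⟨i, hi⟩ := Subspace.exists_eq_top_of_iUnion_eq_univ
      (Set.eq_univ_of_forall fun v => Set.mem_iUnion.2 (hcon v))
    have := h i
    rw [hi, finrank_top, hV] at this
    omega
  have hspan1 (v : Fin 4 → k) : Module.finrank k (Submodule.span k {v}) ≤ 1 :=
    (finrank_span_le_card _).trans (by simp)
  obtain ⟨y, hy⟩ := havoid W fun i => by rw [hW]; norm_num
  obtain ⟨w, hw⟩ := havoid (fun i => W i ⊔ Submodule.span k {y}) fun i => by
    have := Submodule.finrank_add_le_finrank_add_finrank (W i) (Submodule.span k {y})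
    have := hspan1 y
    rw [hW] at *
    omega
  obtain ⟨x, hxW, hx⟩ : ∃ x ∈ W i₀, x ∉ Submodule.span k {z} := by
    by_contra! hcon
    have := (Submodule.finrank_mono (show W i₀ ≤ Submodule.span k {z} from hcon)).trans (hspan1 z)
    rw [hW] at this
    omega
  have hcomp (i : Fin s) : W i ⊔ Submodule.span k {y} ⊔ Submodule.span k {w} = ⊤ := by
    have h1 : W i < W i ⊔ Submodule.span k {y} := left_lt_sup.2 fun h =>
      hy i (h (Submodule.mem_span_singleton_self y))
    have h2 : W i ⊔ Submodule.span k {y} < W i ⊔ Submodule.span k {y} ⊔ Submodule.span k {w} :=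
      left_lt_sup.2 fun h => hw i (h (Submodule.mem_span_singleton_self w))
    have h3 := Submodule.finrank_lt_finrank_of_lt h1
    have h4 := Submodule.finrank_lt_finrank_of_lt h2
    have h5 := Submodule.finrank_le (W i ⊔ Submodule.span k {y} ⊔ Submodule.span k {w})
    rw [hW] at h3
    exact Submodule.eq_top_of_finrank_eq (by omega)
  have hli : LinearIndependent k ![x, y, w, z] := by
    refine Fintype.linearIndependent_iff.2 fun g hg => ?_
    rw [Fin.sum_univ_four] at hg
    simp only [Matrix.cons_val] at hg
    have hdiv {W' : Submodule k (Fin 4 → k)} {v : Fin 4 → k} {c : k} (hv : v ∉ W')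
        (h : c • v ∈ W') : c = 0 := by
      by_contra hc
      exact hv ((Submodule.smul_mem_iff _ hc).1 h)
    have hxz : g 0 • x + g 3 • z ∈ W i₀ :=
      add_mem (Submodule.smul_mem _ _ hxW) (Submodule.smul_mem _ _ hzW)
    have h2 : g 2 = 0 := by
      refine hdiv (hw i₀) ?_
      have : g 2 • w = -((g 0 • x + g 3 • z) + g 1 • y) := by
        rw [eq_neg_iff_add_eq_zero, ← hg]; abel
      rw [this]
      exact neg_mem (add_mem (Submodule.mem_sup_left hxz) (Submodule.mem_sup_right
        (Submodule.smul_mem _ _ (Submodule.mem_span_singleton_self y))))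
    rw [h2, zero_smul, add_zero] at hg
    have h1 : g 1 = 0 := by
      refine hdiv (hy i₀) ?_
      have : g 1 • y = -(g 0 • x + g 3 • z) := by
        rw [eq_neg_iff_add_eq_zero, ← hg]; abel
      rw [this]
      exact neg_mem hxz
    rw [h1, zero_smul, add_zero] at hg
    have h0 : g 0 = 0 := by
      refine hdiv hx ?_
      rw [eq_neg_of_add_eq_zero_left hg]
      exact neg_mem (Submodule.smul_mem _ _ (Submodule.mem_span_singleton_self z))
    rw [h0, zero_smul, zero_add] at hg
    have h3 : g 3 = 0 := (smul_eq_zero.1 hg).resolve_right hz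
    intro c
    fin_cases c
    exacts [h0, h1, h2, h3]
  let b := basisOfLinearIndependentOfCardEqFinrank hli (by simp)
  have hb : ⇑b = ![x, y, w, z] := coe_basisOfLinearIndependentOfCardEqFinrank hli _
  have hex (i : Fin s) (v : Fin 4 → k) : ∃ c d : k, v - c • y - d • w ∈ W i := by
    obtain ⟨t, ht, v', hv', rfl⟩ := Submodule.mem_sup.1 (hcomp i ▸ Submodule.mem_top : v ∈ _)
    obtain ⟨t', ht', v'', hv'', rfl⟩ := Submodule.mem_sup.1 ht
    obtain ⟨d, rfl⟩ := Submodule.mem_span_singleton.1 hv'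
    obtain ⟨c, rfl⟩ := Submodule.mem_span_singleton.1 hv''
    exact ⟨c, d, by convert ht' using 1; module⟩
  have hp (i : Fin s) : ∃ p : LineParam k, (i = i₀ → p = ⟨0, 0, 0, 0⟩) ∧
      x - p.u • y - p.v • w ∈ W i ∧ z - p.a • y - p.b • w ∈ W i := by
    by_cases hi : i = i₀
    · exact ⟨⟨0, 0, 0, 0⟩, fun _ => rfl, by simpa [hi] using hxW, by simpa [hi] using hzW⟩
    · obtain ⟨u, v, huv⟩ := hex i x
      obtain ⟨a, c, hac⟩ := hex i z
      exact ⟨⟨u, v, a, c⟩, fun h => absurd h hi, huv, hac⟩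
  choose p hp0 hpx hpz using hp
  have hWp (i : Fin s) : W i = (p i).subspace b := by
    refine (Submodule.eq_of_le_of_finrank_eq (Submodule.span_le.2 ?_) ?_).symm
    · rw [hb]
      rintro _ (rfl | rfl)
      exacts [hpx i, hpz i]
    · rw [hW]
      exact (p i).finrank_subspace b
  exact ⟨b, p, by rw [hb]; rfl, hp0 i₀ rfl, hWp, fun i j hij =>
    LineParam.det_ne_zero_of_sup_eq_top b (by rw [← hWp, ← hWp]; exact hsup i j hij)⟩

end NormalForm

/-! ### The family in arbitrary coordinates -/

section Coordinates

variable {k : Type u} [Field k] (b : Module.Basis (Fin 4) k (Fin 4 → k))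
  (A : Type u) [CommRing A] [Algebra k A]

/-- The change of coordinates that replaces the variables by the linear forms of a basis. -/
noncomputable def coordEquiv : MvPolynomial (Fin 4) A ≃ₐ[A] MvPolynomial (Fin 4) A :=
  linEquiv A ((Pi.basisFun k (Fin 4)).equiv b (Equiv.refl _))

/-- The change of coordinates `coordEquiv` as a ring homomorphism. -/
noncomputable def coordChange : MvPolynomial (Fin 4) A →+* MvPolynomial (Fin 4) A :=
  (linSubst A ((Pi.basisFun k (Fin 4)).equiv b (Equiv.refl _)).toLinearMap).toRingHom

theorem coordChange_X (j : Fin 4) : coordChange b A (X j) = linForm k A (b j) := by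
  have : (Pi.basisFun k (Fin 4)).equiv b (Equiv.refl _) (Pi.single j 1) = b j := by
    rw [← Pi.basisFun_apply, Module.Basis.equiv_apply, Equiv.refl_apply]
  simp [coordChange, linSubst, this]

theorem coordChange_C (a : A) : coordChange b A (C a) = C a := by
  simp [coordChange]

theorem isHomogeneous_coordChange {n : ℕ} {f : MvPolynomial (Fin 4) A} (hf : f.IsHomogeneous n) :
    (coordChange b A f).IsHomogeneous n :=
  isHomogeneous_linSubst A _ hf

theorem mem_map_coordChange {J : Ideal (MvPolynomial (Fin 4) A)} {f : MvPolynomial (Fin 4) A} :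
    f ∈ J.map (coordChange b A) ↔ (coordEquiv b A).symm f ∈ J := by
  have : J.map (coordChange b A) = J.comap (coordEquiv b A).toRingEquiv.symm :=
    Ideal.map_comap_of_equiv (coordEquiv b A).toRingEquiv
  rw [this]
  rfl

theorem isPrime_map_coordChange {J : Ideal (MvPolynomial (Fin 4) A)} (hJ : J.IsPrime) :
    (J.map (coordChange b A)).IsPrime :=
  Ideal.map_isPrime_of_equiv (coordEquiv b A)

theorem isHomogeneous_map_coordChange {J : Ideal (MvPolynomial (Fin 4) A)}
    (hJ : J.IsHomogeneous (grading A)) :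
    (J.map (coordChange b A)).IsHomogeneous (grading A) := by
  obtain ⟨S, rfl⟩ := (Ideal.IsHomogeneous.iff_exists _ _).1 hJ
  rw [Ideal.map_span]
  refine Ideal.homogeneous_span _ _ ?_
  rintro _ ⟨_, ⟨⟨f, n, hf⟩, -, rfl⟩, rfl⟩
  exact ⟨n, mem_grading.2 (isHomogeneous_coordChange b A (mem_grading.1 hf))⟩

theorem map_coordChange {A B : Type u} [CommRing A] [Algebra k A] [CommRing B] [Algebra k B]
    {φ : A →+* B} (hφ : φ.comp (algebraMap k A) = algebraMap k B)
    (J : Ideal (MvPolynomial (Fin 4) A)) :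
    (J.map (coordChange b A)).map (MvPolynomial.map φ) =
      (J.map (MvPolynomial.map φ)).map (coordChange b B) := by
  rw [Ideal.map_map, Ideal.map_map]
  congr 1
  exact RingHom.ext fun f => map_linSubst A B hφ _ f

theorem X_mem_span_range_linForm (j : Fin 4) :
    X j ∈ Ideal.span (Set.range fun i => linForm k A (b i)) := by
  let I : Submodule k (MvPolynomial (Fin 4) A) :=
    (Ideal.span (Set.range fun i => linForm k A (b i))).restrictScalars k
  have h : Submodule.span k (Set.range b) ≤ I.comap (linForm k A) := by
    rw [Submodule.span_le]
    rintro _ ⟨i, rfl⟩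
    exact Ideal.subset_span ⟨i, rfl⟩
  rw [← linForm_single (k := k)]
  exact h (b.span_eq ▸ Submodule.mem_top)

/-- The affine chart of `ℙ³` on which a coordinate of the basis does not vanish. -/
noncomputable abbrev coordChart (j : Fin 4) : (P3 A).affineOpens :=
  chart (linForm k A (b j)) (linForm_mem_grading A (b j))

/-- Dehomogenization in the coordinates of the basis. -/
noncomputable def coordHom (j : Fin 4) :
    MvPolynomial (Fin 4) A →+* Γ(P3 A, (coordChart b A j).1) :=
  (chartHom (linForm k A (b j)) (linForm_mem_grading A (b j))).comp (coordChange b A)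

theorem coordHom_X (j : Fin 4) : coordHom b A j (X j) = 1 := by
  rw [coordHom, RingHom.comp_apply, coordChange_X, chartHom_self]

variable {A}

theorem map_coordHom (j : Fin 4) (J : Ideal (MvPolynomial (Fin 4) A)) :
    J.map (coordHom b A j) = (J.map (coordChange b A)).map
      (chartHom (linForm k A (b j)) (linForm_mem_grading A (b j))) :=
  (Ideal.map_map _ _).symm

theorem map_coordHom_iInf (j : Fin 4) {ι : Type*} [Finite ι]
    {J : ι → Ideal (MvPolynomial (Fin 4) A)} (hJ : ∀ i, (J i).IsHomogeneous (grading A)) :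
    (⨅ i, J i).map (coordHom b A j) = ⨅ i, (J i).map (coordHom b A j) := by
  have h : (⨅ i, J i).map (coordChange b A) = ⨅ i, (J i).map (coordChange b A) := by
    ext f
    simp only [mem_map_coordChange, Ideal.mem_iInf]
  simp only [map_coordHom]
  rw [h, map_chartHom_iInf _ fun i => isHomogeneous_map_coordChange b A (hJ i)]

theorem map_coordHom_inf (j : Fin 4) {I J : Ideal (MvPolynomial (Fin 4) A)}
    (hI : I.IsHomogeneous (grading A)) (hJ : J.IsHomogeneous (grading A)) :
    (I ⊓ J).map (coordHom b A j) = I.map (coordHom b A j) ⊓ J.map (coordHom b A j) := by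
  have h : (I ⊓ J).map (coordChange b A) = I.map (coordChange b A) ⊓ J.map (coordChange b A) := by
    ext f
    simp only [mem_map_coordChange, Ideal.mem_inf]
  simp only [map_coordHom]
  rw [h, map_chartHom_inf _ (isHomogeneous_map_coordChange b A hI)
    (isHomogeneous_map_coordChange b A hJ)]

theorem vanishingIdeal_ideal_coordChart (j : Fin 4) {J : Ideal (MvPolynomial (Fin 4) A)}
    (hJ : J.IsHomogeneous (grading A)) (hJp : J.IsPrime) :
    (Scheme.IdealSheafData.vanishingIdeal (zeroLocus (J.map (coordChange b A)))).ideal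
      (coordChart b A j) = J.map (coordHom b A j) := by
  rw [map_coordHom]
  exact vanishingIdeal_ideal_chart _ (isHomogeneous_map_coordChange b A hJ)
    (isPrime_map_coordChange b A hJp) fun _ => mem_zeroLocus

theorem sheaf_ext_coordChart {S T : (P3 A).IdealSheafData}
    (h : ∀ j, S.ideal (coordChart b A j) = T.ideal (coordChart b A j)) : S = T :=
  sheaf_ext _ (X_mem_span_range_linForm b A) h

theorem comap_ideal_coordChart {B : Type u} [CommRing B] [Algebra k B] {φ : A →+* B}
    (hφ : φ.comp (algebraMap k A) = algebraMap k B) (j : Fin 4) {S : (P3 A).IdealSheafData}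
    {J : Ideal (MvPolynomial (Fin 4) A)}
    (hS : S.ideal (coordChart b A j) = J.map (coordHom b A j)) :
    (S.comap (P3.map φ)).ideal (coordChart b B j) =
      (J.map (MvPolynomial.map φ)).map (coordHom b B j) := by
  have key (g : MvPolynomial (Fin 4) B) (hg : g ∈ grading B 1)
      (h : MvPolynomial.map φ (linForm k A (b j)) = g) :
      (S.comap (P3.map φ)).ideal (chart g hg) =
        ((J.map (coordChange b A)).map (MvPolynomial.map φ)).map (chartHom g hg) := by
    subst h
    refine comap_ideal_chart φ (linForm_mem_grading A (b j)) ?_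
    rw [← map_coordHom]
    exact hS
  rw [map_coordHom, ← map_coordChange b hφ]
  exact key _ _ (map_linForm A B hφ (b j))

theorem flat_of_torsionFree_coordChart [IsDedekindDomain A] {S : (P3 A).IdealSheafData}
    {J : Ideal (MvPolynomial (Fin 4) A)} (hJ : J.IsHomogeneous (grading A))
    (hS : ∀ j, S.ideal (coordChart b A j) = J.map (coordHom b A j))
    (htf : ∀ a n, a ≠ 0 → C a * n ∈ J → n ∈ J) : Flat (S.subschemeι ≫ P3.toSpec A) := by
  refine flat_of_torsionFree (b := fun j => linForm k A (b j))
    (fun j => linForm_mem_grading A (b j)) (X_mem_span_range_linForm b A)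
    (isHomogeneous_map_coordChange b A hJ) (fun j => ?_) fun a n ha h => ?_
  · rw [← map_coordHom]
    exact hS j
  · rw [mem_map_coordChange] at h ⊢
    refine htf a _ ha ?_
    rwa [map_mul, ← algebraMap_eq, AlgEquiv.commutes] at h

theorem map_coordChange_span_X (T : Set (Fin 4)) :
    (Ideal.span (X '' T)).map (coordChange b k) = linIdeal (Submodule.span k (b '' T)) := by
  rw [Ideal.map_span, linIdeal_span, ← Set.image_comp, ← Set.image_comp]
  congr 1
  exact Set.image_congr fun j _ => coordChange_X b k j

theorem map_coordChange_ideal (p : LineParam k) :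
    p.ideal.map (coordChange b k) = linIdeal (p.subspace b) := by
  have hC (c : k) (v : Fin 4 → k) : linForm k k (c • v) = C c * linForm k k v := by
    rw [map_smul, smul_eq_C_mul]
  rw [LineParam.ideal_eq_span, Ideal.map_span, LineParam.subspace, linIdeal_span, Set.image_pair,
    Set.image_pair]
  simp only [LineParam.form₀, LineParam.form₃, map_sub, map_mul, coordChange_X, coordChange_C, hC]

theorem idealSheaf_subspace_ideal (p : LineParam k) (j : Fin 4) :
    (idealSheaf (zeroLocus (linIdeal (p.subspace b)))).ideal (coordChart b k j) =
      p.ideal.map (coordHom b k j) := by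
  rw [map_coordHom, map_coordChange_ideal]
  exact idealSheaf_zeroLocus_linIdeal_ideal _ _

theorem idealSheaf_span_ideal (T : Set (Fin 4)) (j : Fin 4) :
    (idealSheaf (zeroLocus (linIdeal (Submodule.span k (b '' T))))).ideal (coordChart b k j) =
      (Ideal.span (X '' T)).map (coordHom b k j) := by
  rw [map_coordHom, map_coordChange_span_X]
  exact idealSheaf_zeroLocus_linIdeal_ideal _ _

theorem disjoint_zeroLocus_subspace {p q : LineParam k} (h : p.det q ≠ 0) :
    Disjoint (zeroLocus (linIdeal (p.subspace b))) (zeroLocus (linIdeal (q.subspace b))) := by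
  rw [disjoint_zeroLocus_linIdeal_iff, eq_top_iff, ← b.span_eq, Submodule.span_le]
  rintro _ ⟨j, rfl⟩
  rw [SetLike.mem_coe, ← linForm_mem_linIdeal, linIdeal_sup, ← map_coordChange_ideal,
    ← map_coordChange_ideal, ← Ideal.map_sup, ← coordChange_X]
  exact Ideal.mem_map_of_mem _ (LineParam.X_mem_ideal_sup h j)

end Coordinates

section LineFamily

variable {k : Type u} [Field k] (b : Module.Basis (Fin 4) k (Fin 4 → k)) {s : ℕ}
  (m : Fin s → k) (p : Fin s → LineParam k) (N : ℕ)

/-- The ideal sheaf of the union of the moving lines, with respect to the coordinates `b`. -/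
noncomputable def lineSheaf : (P3 (Polynomial k)).IdealSheafData :=
  ⨅ i, Scheme.IdealSheafData.vanishingIdeal
    (zeroLocus ((movingLine (m i) (p i) N).ideal.map (coordChange b (Polynomial k))))

theorem lineSheaf_ideal (j : Fin 4) :
    (lineSheaf b m p N).ideal (coordChart b (Polynomial k) j) =
      (totalIdeal m p N).map (coordHom b (Polynomial k) j) := by
  rw [totalIdeal, map_coordHom_iInf b j fun i => LineParam.isHomogeneous_ideal _, lineSheaf,
    Scheme.IdealSheafData.ideal_iInf, iInf_apply]
  exact iInf_congr fun i => vanishingIdeal_ideal_coordChart b j (LineParam.isHomogeneous_ideal _)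
    (LineParam.isPrime_ideal _)

/-- The flat family of the unions of the moving lines. -/
noncomputable def lineFamily : FlatFamily k where
  sheaf := lineSheaf b m p N
  flat := flat_of_torsionFree_coordChart b (isHomogeneous_totalIdeal m p N)
    (lineSheaf_ideal b m p N) fun _ _ ha h => mem_totalIdeal_of_C_mul_mem m p N ha h

theorem lineFamily_fiber_ideal (c : k) (j : Fin 4) :
    ((lineFamily b m p N).fiber c).ideal (coordChart b k j) =
      (fiberIdeal m p N c).map (coordHom b k j) :=
  comap_ideal_coordChart b (RingHom.ext fun a => by simp) j (lineSheaf_ideal b m p N j)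

/-- Where the moving lines are disjoint, their union commutes with passing to the fiber. -/
theorem lineFamily_fiber_eq_unionSheaf {c : k}
    (hdet : ∀ i j, i ≠ j → ((movingLine (m i) (p i) N).map (Polynomial.evalRingHom c)).det
      ((movingLine (m j) (p j) N).map (Polynomial.evalRingHom c)) ≠ 0) :
    (lineFamily b m p N).fiber c = unionSheaf fun i => zeroLocus (linIdeal
      (((movingLine (m i) (p i) N).map (Polynomial.evalRingHom c)).subspace b)) := by
  refine sheaf_ext_coordChart b fun j => ?_
  let q (i : Fin s) := (movingLine (m i) (p i) N).map (Polynomial.evalRingHom c)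
  have hU : (unionSheaf fun i => zeroLocus (linIdeal ((q i).subspace b))).ideal (coordChart b k j) =
      ⨅ i, (q i).ideal.map (coordHom b k j) := by
    rw [unionSheaf, Scheme.IdealSheafData.ideal_iInf, iInf_apply]
    exact iInf_congr fun i => idealSheaf_subspace_ideal b (q i) j
  rw [lineFamily_fiber_ideal]
  refine Eq.trans (le_antisymm ?_ ?_) hU.symm
  · rw [← map_coordHom_iInf b j fun i => LineParam.isHomogeneous_ideal _]
    exact Ideal.map_mono (fiberIdeal_le m p N c)
  · have hcop : ((Finset.univ : Finset (Fin s)) : Set (Fin s)).Pairwise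
        (Function.onFun IsCoprime fun i => (q i).ideal.map (coordHom b k j)) := by
      intro i _ i' _ hii'
      rw [Function.onFun, Ideal.isCoprime_iff_sup_eq, ← Ideal.map_sup, Ideal.eq_top_iff_one,
        ← coordHom_X b k j]
      exact Ideal.mem_map_of_mem _ (LineParam.X_mem_ideal_sup (hdet i i' hii') j)
    have h1 := Ideal.prod_eq_iInf_of_pairwise_isCoprime hcop
    simp only [Finset.mem_univ, iInf_pos] at h1
    rw [← h1]
    exact (map_prod (Ideal.mapHom (coordHom b k j)) (fun i => (q i).ideal)
      Finset.univ).symm.le.trans (Ideal.map_mono (prod_le_fiberIdeal m p N c))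

end LineFamily

section Cone

variable {k : Type u} [Field k] (b : Module.Basis (Fin 4) k (Fin 4 → k)) {s : ℕ} {m : Fin s → k}
  {p : Fin s → LineParam k} {N : ℕ}

theorem isHomogeneous_fatPointIdeal (k : Type u) [CommRing k] (s : ℕ) :
    (fatPointIdeal k s).IsHomogeneous (grading k) := by
  have hX (T : Set (Fin 4)) : (Ideal.span (X '' T : Set (MvPolynomial (Fin 4) k))).IsHomogeneous
      (grading k) := by
    refine Ideal.homogeneous_span _ _ ?_
    rintro _ ⟨j, -, rfl⟩
    exact ⟨1, mem_grading.2 (isHomogeneous_X k j)⟩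
  have hpow {I : Ideal (MvPolynomial (Fin 4) k)} (hI : I.IsHomogeneous (grading k)) (n : ℕ) :
      (I ^ n).IsHomogeneous (grading k) := by
    induction n with
    | zero => rw [pow_zero, Ideal.one_eq_top]; exact Ideal.IsHomogeneous.top _
    | succ n ih => rw [pow_succ]; exact ih.mul hI
  have h0 := hpow (hX {0, 1, 3}) s
  have h3 := hpow (hX {3}) 2
  simp only [Set.image_insert_eq, Set.image_singleton] at h0 h3
  exact h0.sup h3

theorem coneSheaf_ideal (m : Fin s → k) (j : Fin 4) :
    (coneSheaf (zeroLocus (linIdeal (Submodule.span k (b '' {3}))))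
      (zeroLocus (linIdeal (Submodule.span k (b '' {0, 1, 3}))))
      fun i => zeroLocus (linIdeal ((⟨m i, 0, 0, 0⟩ : LineParam k).subspace b))).ideal
      (coordChart b k j) = (coneIdeal m).map (coordHom b k j) := by
  have hfat : (fatPointIdeal k s).map (coordHom b k j) =
      (Ideal.span (X '' {0, 1, 3})).map (coordHom b k j) ^ s ⊔
        (Ideal.span (X '' {3})).map (coordHom b k j) ^ 2 := by
    rw [fatPointIdeal, Ideal.map_sup, Ideal.map_pow, Ideal.map_pow]
    simp only [Set.image_insert_eq, Set.image_singleton]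
  rw [coneIdeal, map_coordHom_inf b j (Ideal.IsHomogeneous.iInf fun _ =>
    LineParam.isHomogeneous_ideal _) (isHomogeneous_fatPointIdeal k s),
    map_coordHom_iInf b j fun i => LineParam.isHomogeneous_ideal _, hfat, coneSheaf,
    Scheme.IdealSheafData.ideal_inf, Pi.inf_apply, unionSheaf,
    Scheme.IdealSheafData.ideal_iInf, iInf_apply, fatPointSheaf, Scheme.IdealSheafData.ideal_sup,
    Pi.sup_apply, Scheme.IdealSheafData.ideal_pow, Scheme.IdealSheafData.ideal_pow, Pi.pow_apply,
    Pi.pow_apply, idealSheaf_span_ideal, idealSheaf_span_ideal]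
  congr 1
  exact iInf_congr fun i => idealSheaf_subspace_ideal b _ j

/-- The special fiber of the family of moving lines is the cone. -/
theorem lineFamily_fiber_zero (hs : 1 ≤ s) (hm : Function.Injective m)
    (hp : ∀ i j, i ≠ j → (p i).det (p j) ≠ 0) (hN0 : N ≠ 0) (hN : s ≤ N + 1)
    (hX : X 2 ^ (s - 2) * X 3 ^ 2 ∈ fiberIdeal m p N 0) :
    (lineFamily b m p N).fiber 0 =
      coneSheaf (zeroLocus (linIdeal (Submodule.span k (b '' {3}))))
        (zeroLocus (linIdeal (Submodule.span k (b '' {0, 1, 3}))))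
        fun i => zeroLocus (linIdeal ((⟨m i, 0, 0, 0⟩ : LineParam k).subspace b)) := by
  refine sheaf_ext_coordChart b fun j => ?_
  rw [lineFamily_fiber_ideal, coneSheaf_ideal]
  refine le_antisymm (Ideal.map_mono (fiberIdeal_zero_le_coneIdeal hp hm hN0 hN))
    (Ideal.map_le_iff_le_comap.2 fun g hg => ?_)
  obtain ⟨M, hM⟩ := exists_X_pow_mul_mem_fiberIdeal hs hm hN0 hX j
  have := Ideal.mem_map_of_mem (coordHom b k j) (hM g hg)
  rwa [map_mul, map_pow, coordHom_X, one_pow, one_mul] at this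

theorem isPlaneCone_zeroLocus (hs : 2 ≤ s) (hm : Function.Injective m) :
    IsPlaneCone (zeroLocus (linIdeal (Submodule.span k (b '' {3}))))
      (zeroLocus (linIdeal (Submodule.span k (b '' {0, 1, 3}))))
      fun i => zeroLocus (linIdeal ((⟨m i, 0, 0, 0⟩ : LineParam k).subspace b)) := by
  have hfin (S : Set (Fin 4)) (T : Finset (Fin 4)) (hT : (T : Set (Fin 4)) = S) :
      Module.finrank k (Submodule.span k (b '' S)) = T.card := by
    subst hT
    have := finrank_span_eq_card (b.linearIndependent.comp ((↑) : T → Fin 4)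
      Subtype.val_injective)
    rwa [Set.range_comp, Subtype.range_coe_subtype, Finset.setOfPred_mem, Fintype.card_coe] at this
  have hW (i : Fin s) : (⟨m i, 0, 0, 0⟩ : LineParam k).subspace b =
      Submodule.span k {b 0 - m i • b 1, b 3} := by
    simp [LineParam.subspace]
  have hne (i : Fin s) : (⟨m i, 0, 0, 0⟩ : LineParam k).subspace b ≠ ⊤ := fun h => by
    have := LineParam.finrank_subspace b ⟨m i, 0, 0, 0⟩
    rw [h] at this
    simp at this
  have hle (i : Fin s) : (⟨m i, 0, 0, 0⟩ : LineParam k).subspace b ≤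
      Submodule.span k (b '' {0, 1, 3}) := by
    rw [hW, Submodule.span_le]
    have hb (j : Fin 4) (hj : j ∈ ({0, 1, 3} : Set (Fin 4))) :
        b j ∈ Submodule.span k (b '' {0, 1, 3}) := Submodule.subset_span ⟨j, hj, rfl⟩
    rintro _ (rfl | rfl)
    · exact sub_mem (hb 0 (by simp)) (Submodule.smul_mem _ _ (hb 1 (by simp)))
    · exact hb 3 (by simp)
  have hsub (i j : Fin s) (hij : i ≠ j) {W : Submodule k (Fin 4 → k)}
      (hi : (⟨m i, 0, 0, 0⟩ : LineParam k).subspace b ≤ W)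
      (hj : (⟨m j, 0, 0, 0⟩ : LineParam k).subspace b ≤ W) :
      Submodule.span k (b '' {0, 1, 3}) ≤ W := by
    rw [hW, Submodule.span_le] at hi hj
    have h3 : b 3 ∈ W := hi (by simp)
    have hi0 : b 0 - m i • b 1 ∈ W := hi (by simp)
    have hj0 : b 0 - m j • b 1 ∈ W := hj (by simp)
    have h1 : b 1 ∈ W := by
      refine (Submodule.smul_mem_iff W (sub_ne_zero.2 (hm.ne hij))).1 ?_
      convert sub_mem hj0 hi0 using 1
      module
    have h0 : b 0 ∈ W := by
      convert add_mem hi0 (W.smul_mem (m i) h1) using 1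
      module
    rw [Submodule.span_le]
    rintro _ ⟨j, (rfl | rfl | rfl), rfl⟩
    exacts [h0, h1, h3]
  refine ⟨isLinearSubspace_iff.2 ⟨_, hfin _ {3} (by simp), rfl⟩,
    isLinearSubspace_iff.2 ⟨_, hfin _ {0, 1, 3} (by simp), rfl⟩,
    fun i => isLinearSubspace_iff.2 ⟨_, LineParam.finrank_subspace b _, rfl⟩, fun i j hij => ?_,
    fun i => ?_, le_antisymm ?_ ?_⟩
  · by_contra hne'
    have h := hsub i j hne' le_rfl ((zeroLocus_linIdeal_le_iff (hne i)).1 (le_of_eq hij))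
    have := Submodule.finrank_mono h
    rw [LineParam.finrank_subspace, hfin _ {0, 1, 3} (by simp)] at this
    simp at this
  · rw [zeroLocus_linIdeal_le_iff (hne i), hW, Submodule.span_le]
    rintro _ ⟨_, rfl, rfl⟩
    exact Submodule.subset_span (by simp)
  · intro x hx
    have hx' := Closeds.mem_iInf.1 hx
    have h01 := hsub ⟨0, by omega⟩ ⟨1, by omega⟩ (by simp) le_sup_left le_sup_right
    refine mem_zeroLocus.2 ((linIdeal_mono h01).trans ?_)
    rw [linIdeal_sup]
    exact sup_le (hx' _) (hx' _)
  · exact le_iInf fun i x hx => mem_zeroLocus.2 ((linIdeal_mono (hle i)).trans hx)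

end Cone

end LineDegeneration

open LineDegeneration in
theorem lemma3p9 {k : Type u} [Field k] [IsAlgClosed k] [CharZero k] (s : ℕ) (hs : 3 ≤ s)
    (L : Fin s → Closeds (P3 k)) (hL : AreDisjointLines L)
    (H : Closeds (P3 k)) (hH : IsPlane H) (hLH : L ⟨0, by omega⟩ ≤ H) :
    ∃ (P : Closeds (P3 k)) (L' : Fin s → Closeds (P3 k)) (X : FlatFamily k),
      L' ⟨0, by omega⟩ = L ⟨0, by omega⟩ ∧
      IsPlaneCone H P L' ∧
      X.fiber 0 = coneSheaf H P L' ∧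
      {a : k | ¬ ∃ M : Fin s → Closeds (P3 k),
        AreDisjointLines M ∧ X.fiber a = unionSheaf M}.Finite ∧
      ∃ a : k, X.fiber a = unionSheaf L := by
  choose W hW hLW using fun i => isLinearSubspace_iff.1 (hL.1 i)
  obtain rfl : L = fun i => zeroLocus (linIdeal (W i)) := funext hLW
  obtain ⟨WH, hWH, rfl⟩ := isLinearSubspace_iff.1 hH
  obtain ⟨z, hz, rfl⟩ : ∃ z ≠ 0, WH = Submodule.span k {z} := by
    obtain ⟨⟨z, hzW⟩, hz, hspan⟩ := finrank_eq_one_iff'.1 hWH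
    refine ⟨z, fun h => hz (Subtype.ext h), le_antisymm (fun v hv => ?_) ?_⟩
    · obtain ⟨c, hc⟩ := hspan ⟨v, hv⟩
      exact Submodule.mem_span_singleton.2 ⟨c, congrArg Subtype.val hc⟩
    · rwa [Submodule.span_singleton_le_iff_mem]
  have hWtop (i : Fin s) : W i ≠ ⊤ := fun h => by
    have := hW i
    rw [h] at this
    simp at this
  have hzW : z ∈ W ⟨0, by omega⟩ := by
    rw [← Submodule.span_singleton_le_iff_mem]
    exact (zeroLocus_linIdeal_le_iff (hWtop _)).1 hLH
  have : Infinite k := IsAlgClosed.instInfinite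
  obtain ⟨b, p, rfl, hp0, hWp, hdet⟩ := exists_basis_lineParam hW
    (fun i j hij => disjoint_zeroLocus_linIdeal_iff.1 (hL.2 hij)) hz hzW
  obtain rfl : W = fun i => (p i).subspace b := funext hWp
  let m (i : Fin s) : k := (i : ℕ)
  have hm : Function.Injective m := Nat.cast_injective.comp Fin.val_injective
  obtain ⟨N₀, hN₀⟩ := exists_X_pow_mul_X_sq_mem_fiberIdeal (p := p) (by omega : 2 ≤ s) hm
  let N := max N₀ s
  have hb3 : b '' {3} = {b 3} := Set.image_singleton
  rw [← hb3]
  refine ⟨_, _, lineFamily b m p N, ?_, isPlaneCone_zeroLocus b (by omega) hm,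
    lineFamily_fiber_zero b (by omega) hm hdet (by omega) (by omega) (hN₀ N (by omega)), ?_, 1, ?_⟩
  · simp [hp0, m]
  · refine (finite_setOf_det_eq_zero m p N hdet).subset fun c hc => ?_
    by_contra hcon
    have hdet' : ∀ i j, i ≠ j → ((movingLine (m i) (p i) N).map (Polynomial.evalRingHom c)).det
        ((movingLine (m j) (p j) N).map (Polynomial.evalRingHom c)) ≠ 0 :=
      fun i j hij h => hcon ⟨i, j, hij, h⟩
    exact hc ⟨_, ⟨fun i => isLinearSubspace_iff.2 ⟨_, LineParam.finrank_subspace b _, rfl⟩,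
      fun i j hij => disjoint_zeroLocus_subspace b (hdet' i j hij)⟩,
      lineFamily_fiber_eq_unionSheaf b m p N hdet'⟩
  · rw [lineFamily_fiber_eq_unionSheaf]
    · simp only [movingLine_eval_one]
    · simpa only [movingLine_eval_one] using hdet
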